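/- **Notation.** For $d\ge 0$ let $\mathcal S^d$ and $\mathcal S^d_{++}$ be the sets of symmetric, respectively symmetric positive definite, real $d\times d$ matrices. For measurable $U:\mathbb R^d\to\mathbb R$ and $A\in\mathcal S^d$ put $$\Omega_d[A,U]=-\log\int_{\mathbb R^d}e^{-\frac12x^TAx-U(x)}\,dx\in\mathbb R\cup\{-\infty\},\qquad \mathrm{dom}\,\Omega_d[\cdot,U]=\{A\in\mathcal S^d:\Omega_d[A,U]>-\infty\}.$$ $U$ satisfies the *weak growth condition* if it is measurable, there is a constant $C_U$ with $U(x)+C_U(1+\|x\|^2)\ge 0$ for all $x\in\mathbb R^d$, and $\mathrm{dom}\,\Omega_d[\cdot,U]$ is open in $\mathcal S^d$. For $G\in\mathcal S^d_{++}$ let $$\mathcal F_d[G,U]=\sup_{\mu}\Big[H(\mu)-\int U\,d\mu\Big],$$ where $\mu$ runs over the Borel probability measures on $\mathbb R^d$ with finite second moments and $\int xx^T\,d\mu=G$, and $H(\mu)=-\int\log\frac{d\mu}{dx}\,d\mu$ is the differential entropy ($H(\mu)=-\infty$ if $\mu$ is not absolutely continuous with respect to Lebesgue measure). The Luttinger–Ward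 functional is $$\Phi_d[G,U]=2\mathcal F_d[G,U]-\mathrm{Tr}[\log G]-d\log(2\pi e),$$ and the self-energy is $\Sigma_d[G,U]=\frac12\nabla\Phi_d[G,U]$, the gradient with respect to $G$ of a function $f$ of symmetric matrices being defined by $(\nabla f)_{ij}(G)=\frac{d}{dt}\big|_{t=0}f(G+tE^{(ij)})$ with $E^{(ij)}_{kl}=\delta_{ik}\delta_{jl}+\delta_{il}\delta_{jk}$. **Corollary 3.8.** Let $0\le p\le N$ and let $U:\mathbb R^N\to\mathbb R$ satisfy the weak growth condition and depend only on $x_1,\dots,x_p$; regard $U$ also as the function $U(\cdot,0)$ on $\mathbb R^p$. Then the self-energies $\Sigma_N[\cdot,U]$ and $\Sigma_p[\cdot,U]$ are well defined on $\mathcal S^N_{++}$ and $\mathcal S^p_{++}$ (that is, $\mathcal F_d[\cdot,U]$ is finite and $\Phi_d[\cdot,U]$ is differentiable on $\mathcal S^d_{++}$ for $d=N$ and $d=p$), and for every $G\in\mathcal S^N_{++}$ with upper-left $p\times p$ block $G_{11}$, $$\Sigma_N[G,U]=\begin{pmatrix}\Sigma_p[G_{11},U]&0\\0&0\end{pmatrix}.$$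 In particular all nonzero entries of $\Sigma_N[G,U]$ lie in the impurity block. -/

import Mathlib

open MeasureTheory

noncomputable section

namespace LuttingerWard

variable {ι : Type*} [Fintype ι] [DecidableEq ι]

/-- The space of real symmetric matrices, with the subspace topology. -/
abbrev SymMat (ι : Type*) := {A : Matrix ι ι ℝ // A.IsSymm}

/-- The partition function `Z[A, U] = ∫ exp (-½ xᵀ A x - U x) dx`, which may be infinite. -/
def partitionFunction (U : (ι → ℝ) → ℝ) (A : SymMat ι) : ENNReal :=
  ∫⁻ x : ι → ℝ, ENNReal.ofReal (Real.exp (-(1 / 2) * (x ⬝ᵥ A.1.mulVec x) - U x))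

/-- The free energy `Ω[A, U] = -log Z[A, U]`, equal to `-∞` where the integral diverges. -/
def freeEnergy (U : (ι → ℝ) → ℝ) (A : SymMat ι) : EReal :=
  -ENNReal.log (partitionFunction U A)

/-- The effective domain `{A | Ω[A, U] > -∞}` of the free energy, a set of symmetric matrices. -/
def freeEnergyDomain (U : (ι → ℝ) → ℝ) : Set (SymMat ι) :=
  {A | ⊥ < freeEnergy U A}

/-- The weak growth condition (the sum of squares is the squared Euclidean norm). -/
structure WeakGrowth (U : (ι → ℝ) → ℝ) : Prop where
  measurable : Measurable U
  lower_bound : ∃ C : ℝ, ∀ x, 0 ≤ U x + C * (1 + ∑ i, x i ^ 2)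
  isOpen_domain : IsOpen (freeEnergyDomain U)

/-- The Lebesgue integral of a real function with values in the extended reals, that is, the
integral of the positive part minus the integral of the negative part. -/
def extIntegral {α : Type*} [MeasurableSpace α] (μ : Measure α) (f : α → ℝ) : EReal :=
  ((∫⁻ x, ENNReal.ofReal (f x) ∂μ : ENNReal) : EReal)
    - ((∫⁻ x, ENNReal.ofReal (-f x) ∂μ : ENNReal) : EReal)

open Classical in
/-- The differential entropy `H(μ) = -∫ log (dμ/dλ) dμ` with respect to Lebesgue measure `λ`,
and `-∞` when `μ` is not absolutely continuous. -/
def entropy (μ : Measure (ι → ℝ)) : EReal :=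
  if μ ≪ volume then
    extIntegral μ (fun x => -Real.log ((μ.rnDeriv volume x).toReal))
  else ⊥

/-- Probability measures with finite second moments. -/
structure IsProbWithSecondMoments (μ : Measure (ι → ℝ)) : Prop where
  isProbabilityMeasure : IsProbabilityMeasure μ
  integrable_sq : ∀ i, Integrable (fun x : ι → ℝ => x i ^ 2) μ

/-- The matrix `∫ x xᵀ dμ` of second moments. -/
def secondMoment (μ : Measure (ι → ℝ)) : Matrix ι ι ℝ :=
  Matrix.of fun i j => ∫ x, x i * x j ∂μ

/-- `F[G, U]`, the supremum of `H(μ) - ∫ U dμ` over all probability measures `μ` with finite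
second moments and second moment matrix `G` (it is `-∞` if there are none). -/
def dualFreeEnergy (U : (ι → ℝ) → ℝ) (G : Matrix ι ι ℝ) : EReal :=
  ⨆ (μ : Measure (ι → ℝ)) (_ : IsProbWithSecondMoments μ ∧ secondMoment μ = G),
    entropy μ - extIntegral μ U

/-- The Luttinger-Ward functional `Φ[G, U] = 2 F[G, U] - Tr log G - N log (2πe)`, where `log G` is
the matrix logarithm. It is meaningful for positive definite `G` with `F[G, U]` finite. -/
def luttingerWard (U : (ι → ℝ) → ℝ) (G : Matrix ι ι ℝ) : ℝ :=
  2 * (dualFreeEnergy U G).toReal - (cfc Real.log G).trace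
    - Fintype.card ι * Real.log (2 * Real.pi * Real.exp 1)

/-- The symmetric direction `E^(ij)`, with entries `δ_ik δ_jl + δ_il δ_jk`. -/
def symDirection (i j : ι) : Matrix ι ι ℝ :=
  Matrix.of fun k l =>
    (if i = k then 1 else 0) * (if j = l then 1 else 0)
      + (if i = l then 1 else 0) * (if j = k then 1 else 0)

/-- The gradient of a function of symmetric matrices: `(∇f)_ij` is the derivative of `f` in the
direction `E^(ij)`. -/
def symGradient (f : Matrix ι ι ℝ → ℝ) (G : Matrix ι ι ℝ) : Matrix ι ι ℝ :=
  Matrix.of fun i j => deriv (fun t : ℝ => f (G + t • symDirection i j)) 0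

/-- The self-energy `Σ[G, U] = ½ ∇Φ[G, U]`. -/
def selfEnergy (U : (ι → ℝ) → ℝ) (G : Matrix ι ι ℝ) : Matrix ι ι ℝ :=
  (1 / 2 : ℝ) • symGradient (luttingerWard U) G

/-- The self-energy functional is genuinely defined on all positive definite matrices: there
`F` is finite, so that `Φ` is a real function, and `Φ` is (Fréchet) differentiable as a function
on the set of positive definite matrices, a relatively open subset of the symmetric matrices. -/
structure SelfEnergyWellDefined (U : (ι → ℝ) → ℝ) : Prop where
  finite : ∀ G : Matrix ι ι ℝ, G.PosDef → dualFreeEnergy U G ≠ ⊥ ∧ dualFreeEnergy U G ≠ ⊤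
  differentiableOn : DifferentiableOn ℝ (luttingerWard U) {G : Matrix ι ι ℝ | G.PosDef}

/-- A function on `ℝ^p × ℝ^q` which depends only on the first `p` variables, regarded as a function
on `ℝ^p` (the remaining variables are set to `0`). -/
def onFragment {κ : Type*} (U : (ι ⊕ κ → ℝ) → ℝ) : (ι → ℝ) → ℝ :=
  fun y => U (Sum.elim y 0)

end LuttingerWard

end

/-! By convex duality, `F[G, U]` is the minimum over symmetric `A` of `½ Tr (A G) + log Z[A, U]`.
The upper bound is the Gibbs variational inequality (`entropy_sub_le`). Equality holds as soon as
the probability density proportional to `exp (-½ xᵀ A x - U x)` has second moments `G`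
(`IsGibbs.dualFreeEnergy_eq`).

Such an `A` exists for every positive definite `G` (`exists_isGibbs`): the dual objective is lower
semicontinuous and coercive, so it has a minimizer, and openness of the domain of `Ω` allows
differentiation there, the first order condition being the moment condition. Strict convexity makes
`A` unique; coercivity, locally uniform in `G`, makes it continuous in `G` (`tendsto_of_isGibbs`).
Hence `F` is differentiable, with derivative the pairing with `½ A`.

For the block formula, write `G = T diag(G₁₁, 1) Tᵀ` with `T` block lower triangular and identity
upper-left block. Since `T` does not move the fragment coordinates, it preserves `U`. It therefore
carries the Gibbs measure for `diag(G₁₁, 1)`, which is the fragment Gibbs measure times a standard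
Gaussian, to the one for `G`. In `Φ` the Jacobian of `T` cancels against `Tr log G`, and the
Gaussian factor against the constant, so `Φ` depends on `G₁₁` only (`luttingerWard_eq_onFragment`).
Differentiation then leaves only the fragment block. -/

namespace LuttingerWard

open MeasureTheory Filter Topology

variable {ι : Type*} [Fintype ι]

/-! ### Quadratic forms, Boltzmann weights and Gibbs moments -/

/-- The entrywise pairing of two matrices. -/
def pairing (A G : Matrix ι ι ℝ) : ℝ := ∑ i, ∑ j, A i j * G i j

theorem pairing_add_left (A B G : Matrix ι ι ℝ) :
    pairing (A + B) G = pairing A G + pairing B G := by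
  simp [pairing, add_mul, Finset.sum_add_distrib]

theorem pairing_smul_left (c : ℝ) (A G : Matrix ι ι ℝ) :
    pairing (c • A) G = c * pairing A G := by
  simp [pairing, Finset.mul_sum, mul_assoc]

theorem pairing_sub_left (A B G : Matrix ι ι ℝ) :
    pairing (A - B) G = pairing A G - pairing B G := by
  simp [pairing, sub_mul, Finset.sum_sub_distrib]

theorem pairing_sub_right (A G H : Matrix ι ι ℝ) :
    pairing A (G - H) = pairing A G - pairing A H := by
  simp [pairing, mul_sub, Finset.sum_sub_distrib]

theorem pairing_eq_trace {A : Matrix ι ι ℝ} (hA : A.IsSymm) (G : Matrix ι ι ℝ) :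
    pairing A G = (A * G).trace := by
  rw [pairing, Finset.sum_comm]
  simp only [Matrix.trace, Matrix.diag, Matrix.mul_apply]
  exact Finset.sum_congr rfl fun i _ => Finset.sum_congr rfl fun j _ => by rw [hA.apply i j]

theorem quadForm_eq_pairing (A : Matrix ι ι ℝ) (x : ι → ℝ) :
    x ⬝ᵥ A.mulVec x = pairing A (Matrix.vecMulVec x x) := by
  simp only [pairing, dotProduct, Matrix.mulVec, Matrix.vecMulVec_apply, Finset.mul_sum]
  exact Finset.sum_congr rfl fun i _ => Finset.sum_congr rfl fun j _ => by ring

theorem quadForm_eq_sum (A : Matrix ι ι ℝ) (x : ι → ℝ) :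
    x ⬝ᵥ A.mulVec x = ∑ i, ∑ j, A i j * (x i * x j) := by
  rw [quadForm_eq_pairing]; rfl

@[fun_prop]
theorem continuous_pairing {X : Type*} [TopologicalSpace X] {A G : X → Matrix ι ι ℝ}
    (hA : Continuous A) (hG : Continuous G) : Continuous fun t => pairing (A t) (G t) := by
  unfold pairing
  exact continuous_finsetSum _ fun i _ => continuous_finsetSum _ fun j _ =>
    (hA.matrix_elem i j).mul (hG.matrix_elem i j)

@[fun_prop]
theorem continuous_quadForm {X : Type*} [TopologicalSpace X] {A : X → Matrix ι ι ℝ}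
    {x : X → ι → ℝ} (hA : Continuous A) (hx : Continuous x) :
    Continuous fun t => x t ⬝ᵥ (A t).mulVec (x t) :=
  hx.dotProduct (hA.matrix_mulVec hx)

theorem neg_mul_le_quadForm (A : Matrix ι ι ℝ) (x : ι → ℝ) :
    -(∑ i, ∑ j, |A i j|) * ∑ k, x k ^ 2 ≤ x ⬝ᵥ A.mulVec x := by
  rw [quadForm_eq_sum, neg_mul, Finset.sum_mul, ← Finset.sum_neg_distrib]
  refine Finset.sum_le_sum fun i _ => ?_
  rw [Finset.sum_mul, ← Finset.sum_neg_distrib]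
  refine Finset.sum_le_sum fun j _ => ?_
  have hi : x i ^ 2 ≤ ∑ k, x k ^ 2 :=
    Finset.single_le_sum (f := fun k => x k ^ 2) (fun k _ => sq_nonneg _) (Finset.mem_univ i)
  have hj : x j ^ 2 ≤ ∑ k, x k ^ 2 :=
    Finset.single_le_sum (f := fun k => x k ^ 2) (fun k _ => sq_nonneg _) (Finset.mem_univ j)
  have hij : |x i * x j| ≤ ∑ k, x k ^ 2 := by
    rw [abs_le]
    constructor <;> nlinarith [sq_nonneg (x i + x j), sq_nonneg (x i - x j)]
  have h1 : |A i j * (x i * x j)| ≤ |A i j| * ∑ k, x k ^ 2 := by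
    rw [abs_mul]; gcongr
  exact (neg_le_neg h1).trans (neg_abs_le _)

/-- The Boltzmann weight `exp (-½ xᵀ A x - U x)`. -/
noncomputable def weight (U : (ι → ℝ) → ℝ) (A : Matrix ι ι ℝ) (x : ι → ℝ) : ℝ :=
  Real.exp (-(1 / 2) * (x ⬝ᵥ A.mulVec x) - U x)

variable {U : (ι → ℝ) → ℝ} {A G : Matrix ι ι ℝ}

theorem weight_pos (x : ι → ℝ) : 0 < weight U A x := Real.exp_pos _

@[fun_prop]
theorem measurable_quadForm (A : Matrix ι ι ℝ) :
    Measurable fun x : ι → ℝ => x ⬝ᵥ A.mulVec x :=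
  (continuous_quadForm continuous_const continuous_id).measurable

theorem measurable_weight (hU : Measurable U) (A : Matrix ι ι ℝ) : Measurable (weight U A) := by
  unfold weight
  fun_prop

theorem integrable_weight_iff (hU : Measurable U) (A : SymMat ι) :
    Integrable (weight U A.1) ↔ partitionFunction U A < ⊤ := by
  rw [Integrable, and_iff_right (measurable_weight hU _).aestronglyMeasurable,
    hasFiniteIntegral_iff_ofReal (Eventually.of_forall fun x => (weight_pos x).le)]
  rfl

theorem mem_freeEnergyDomain_iff (hU : Measurable U) (A : SymMat ι) :
    A ∈ freeEnergyDomain U ↔ Integrable (weight U A.1) := by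
  rw [integrable_weight_iff hU]
  simp only [freeEnergyDomain, freeEnergy, Set.mem_ofPred_eq]
  rw [bot_lt_iff_ne_bot, lt_top_iff_ne_top, Ne, EReal.neg_eq_bot_iff, ENNReal.log_eq_top_iff]

theorem integral_weight_pos (h : Integrable (weight U A)) : 0 < ∫ x, weight U A x :=
  integral_exp_pos h

/-- The sum of squares weight is integrable. -/
theorem integrable_exp_neg_half_sum_sq :
    Integrable fun x : ι → ℝ => Real.exp (-(1 / 2) * ∑ i, x i ^ 2) := by
  have h : (fun x : ι → ℝ => Real.exp (-(1 / 2) * ∑ i, x i ^ 2))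
      = fun x => ∏ i, Real.exp (-(1 / 2) * x i ^ 2) := by
    ext x; rw [Finset.mul_sum, Real.exp_sum]
  rw [h]
  exact Integrable.fintype_prod (f := fun _ t => Real.exp (-(1 / 2) * t ^ 2))
    fun _ => integrable_exp_neg_mul_sq (by norm_num)

/-- `U` is measurable and bounded below by a quadratic polynomial. -/
structure QuadraticallyBounded (U : (ι → ℝ) → ℝ) : Prop where
  measurable : Measurable U
  lower_bound : ∃ C : ℝ, 0 ≤ C ∧ ∀ x, -(C * (1 + ∑ i, x i ^ 2)) ≤ U x

theorem WeakGrowth.quadraticallyBounded (h : WeakGrowth U) : QuadraticallyBounded U := by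
  refine ⟨h.measurable, ?_⟩
  obtain ⟨C, hC⟩ := h.lower_bound
  refine ⟨max C 0, le_max_right _ _, fun x => ?_⟩
  have h1 : 0 ≤ 1 + ∑ i, x i ^ 2 :=
    add_nonneg zero_le_one (Finset.sum_nonneg fun i _ => sq_nonneg _)
  have := mul_le_mul_of_nonneg_right (le_max_left C 0) h1
  linarith [hC x]

/-- A large multiple of the identity beats the quadratic lower bound on `U`: with coefficient `2 * C
+ 1` the exponent is at most `C - ½ ∑ xᵢ²`. -/
theorem exists_integrable_weight [DecidableEq ι] (h : QuadraticallyBounded U) :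
    ∃ A : Matrix ι ι ℝ, A.IsSymm ∧ Integrable (weight U A) := by
  obtain ⟨C, hC, hb⟩ := h.lower_bound
  refine ⟨(2 * C + 1) • 1, by simp [Matrix.IsSymm], ?_⟩
  refine (integrable_exp_neg_half_sum_sq.const_mul (Real.exp C)).mono'
    (measurable_weight h.measurable _).aestronglyMeasurable (Eventually.of_forall fun x => ?_)
  rw [Real.norm_of_nonneg (weight_pos x).le, weight, ← Real.exp_add]
  have : x ⬝ᵥ ((2 * C + 1) • (1 : Matrix ι ι ℝ)).mulVec x = (2 * C + 1) * ∑ i, x i ^ 2 := by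
    simp only [Matrix.smul_mulVec, Matrix.one_mulVec, dotProduct_smul, smul_eq_mul]
    simp [dotProduct, sq]
  rw [this]
  apply Real.exp_le_exp.2
  linarith [hb x]

/-- `G` is the matrix of second moments of the Gibbs measure with weight `weight U A`. -/
structure IsGibbs (U : (ι → ℝ) → ℝ) (A G : Matrix ι ι ℝ) : Prop where
  isSymm : A.IsSymm
  integrable : Integrable (weight U A)
  integrable_mul : ∀ i j, Integrable fun x => x i * x j * weight U A x
  integral_mul : ∀ i j, ∫ x, x i * x j * weight U A x = G i j * ∫ x, weight U A x

theorem IsGibbs.integrable_quadForm (h : IsGibbs U A G) (B : Matrix ι ι ℝ) :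
    Integrable fun x => (x ⬝ᵥ B.mulVec x) * weight U A x := by
  simp only [quadForm_eq_sum, Finset.sum_mul]
  refine integrable_finsetSum _ fun i _ => integrable_finsetSum _ fun j _ => ?_
  simpa only [mul_assoc] using (h.integrable_mul i j).const_mul (B i j)

theorem IsGibbs.integral_quadForm (h : IsGibbs U A G) (B : Matrix ι ι ℝ) :
    ∫ x, (x ⬝ᵥ B.mulVec x) * weight U A x = pairing B G * ∫ x, weight U A x := by
  simp only [quadForm_eq_sum, Finset.sum_mul, pairing]
  have hint : ∀ i j, Integrable fun x : ι → ℝ => B i j * (x i * x j) * weight U A x := fun i j => by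
    simpa only [mul_assoc] using (h.integrable_mul i j).const_mul (B i j)
  rw [integral_finsetSum _ fun i _ => integrable_finsetSum _ fun j _ => hint i j]
  refine Finset.sum_congr rfl fun i _ => ?_
  rw [integral_finsetSum _ fun j _ => hint i j]
  refine Finset.sum_congr rfl fun j _ => ?_
  simp only [mul_assoc, integral_const_mul]
  rw [← h.integral_mul i j]
  simp only [mul_assoc]

/-- The energy `U` is integrable with respect to a Gibbs measure. -/
theorem IsGibbs.integrable_potential (hU : QuadraticallyBounded U) (h : IsGibbs U A G) :
    Integrable fun x => U x * weight U A x := by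
  obtain ⟨C, hC, hb⟩ := hU.lower_bound
  set a := ∑ i, ∑ j, |A i j| with ha
  have ha0 : 0 ≤ a := Finset.sum_nonneg fun i _ => Finset.sum_nonneg fun j _ => abs_nonneg _
  have h1 : Integrable fun x => (a + 1 + C) * ((1 + ∑ i, x i ^ 2) * weight U A x)
      + 2 * Real.exp (-(1 / 2) * ∑ i, x i ^ 2) := by
    refine Integrable.add (Integrable.const_mul ?_ _) (integrable_exp_neg_half_sum_sq.const_mul 2)
    simp only [add_mul, one_mul, Finset.sum_mul]
    refine h.integrable.add (integrable_finsetSum _ fun i _ => ?_)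
    simpa only [sq] using h.integrable_mul i i
  refine h1.mono' (hU.measurable.mul (measurable_weight hU.measurable _)).aestronglyMeasurable
    (Eventually.of_forall fun x => ?_)
  set s := ∑ i, x i ^ 2 with hs
  have hs0 : 0 ≤ s := Finset.sum_nonneg fun i _ => sq_nonneg _
  have hw := weight_pos (U := U) (A := A) x
  rw [Real.norm_eq_abs, abs_mul, abs_of_pos hw]
  -- Where `|U|` is at most quadratic, second moments suffice. Elsewhere `U` is positive and `U ≤ 2
  -- exp (U / 2)`; the factor `exp (-U / 2)` left over from the weight outweighs the quadratic form,
  -- leaving a Gaussian bound.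
  by_cases hle : |U x| ≤ (a + 1 + C) * (1 + s)
  · have := mul_le_mul_of_nonneg_right hle hw.le
    have h2 := Real.exp_pos (-(1 / 2) * s)
    rw [mul_assoc] at this
    linarith
  · push Not at hle
    have hpos : 0 ≤ U x := by
      by_contra hneg
      push Not at hneg
      rw [abs_of_neg hneg] at hle
      have := hb x
      have : 0 ≤ (a + 1) * (1 + s) := by positivity
      nlinarith
    rw [abs_of_nonneg hpos] at hle ⊢
    have h2 : 0 ≤ (a + 1 + C) * ((1 + s) * weight U A x) := by positivity
    have h3 : U x / 2 ≤ Real.exp (U x / 2) := by linarith [Real.add_one_le_exp (U x / 2)]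
    have h4 : U x * weight U A x ≤ 2 * Real.exp (U x / 2) * weight U A x := by gcongr; linarith
    have h5 : 2 * Real.exp (U x / 2) * weight U A x ≤ 2 * Real.exp (-(1 / 2) * s) := by
      rw [mul_assoc, weight, ← Real.exp_add]
      gcongr
      have := neg_mul_le_quadForm A x
      rw [← ha, ← hs] at this
      have : 0 ≤ C * (1 + s) := by positivity
      nlinarith
    linarith

end LuttingerWard

/-! ### The Gibbs variational principle -/

namespace LuttingerWard

open MeasureTheory Filter Topology

section ExtIntegral

variable {α : Type*} [MeasurableSpace α] {μ : Measure α} {f g k : α → ℝ}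

theorem extIntegral_of_integrable (hf : Integrable f μ) :
    extIntegral μ f = ((∫ x, f x ∂μ : ℝ) : EReal) := by
  rw [integral_eq_lintegral_pos_part_sub_lintegral_neg_part hf, extIntegral, EReal.coe_sub]
  have h1 : ∫⁻ x, ENNReal.ofReal (f x) ∂μ ≠ ⊤ := hf.lintegral_lt_top.ne
  have h2 : ∫⁻ x, ENNReal.ofReal (-f x) ∂μ ≠ ⊤ := hf.neg.lintegral_lt_top.ne
  rw [EReal.coe_ennreal_toReal h1, EReal.coe_ennreal_toReal h2]

theorem integrable_of_lintegral_ofReal_ne_top (hf : Measurable f)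
    (h1 : ∫⁻ x, ENNReal.ofReal (f x) ∂μ ≠ ⊤) (h2 : ∫⁻ x, ENNReal.ofReal (-f x) ∂μ ≠ ⊤) :
    Integrable f μ := by
  refine ⟨hf.aestronglyMeasurable, ?_⟩
  rw [hasFiniteIntegral_iff_norm]
  calc ∫⁻ x, ENNReal.ofReal ‖f x‖ ∂μ
      ≤ ∫⁻ x, (ENNReal.ofReal (f x) + ENNReal.ofReal (-f x)) ∂μ := by
        refine lintegral_mono fun x => ?_
        rw [Real.norm_eq_abs]
        rcases abs_cases (f x) with ⟨h, _⟩ | ⟨h, _⟩ <;> rw [h]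
        · exact le_self_add
        · exact le_add_self
    _ = _ := lintegral_add_left hf.ennreal_ofReal _
    _ < ⊤ := ENNReal.add_lt_top.2 ⟨h1.lt_top, h2.lt_top⟩

/-- Neither `f` nor `g` need be integrable: if the integral of `g` is `⊤` or that of `f` is `⊥`, the
difference is `⊥`, and otherwise this is monotonicity of the ordinary integral. The condition on the
negative part of `g` excludes the ambiguous cases. -/
theorem extIntegral_sub_extIntegral_le (hf : Measurable f) (hg : Measurable g)
    (hk : Integrable k μ) (hg' : ∫⁻ x, ENNReal.ofReal (-g x) ∂μ ≠ ⊤)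
    (hfg : ∀ᵐ x ∂μ, f x ≤ g x + k x) :
    extIntegral μ f - extIntegral μ g ≤ ((∫ x, k x ∂μ : ℝ) : EReal) := by
  by_cases hgp : ∫⁻ x, ENNReal.ofReal (g x) ∂μ = ⊤
  · have : extIntegral μ g = ⊤ := by
      rw [extIntegral, hgp, ← EReal.coe_ennreal_toReal hg']
      simp
    rw [this]; simp
  have hgi : Integrable g μ := integrable_of_lintegral_ofReal_ne_top hg hgp hg'
  have hfp : ∫⁻ x, ENNReal.ofReal (f x) ∂μ ≠ ⊤ := by
    refine ne_top_of_le_ne_top (hgi.add hk).lintegral_lt_top.ne (lintegral_mono_ae ?_)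
    filter_upwards [hfg] with x hx using ENNReal.ofReal_le_ofReal hx
  by_cases hfn : ∫⁻ x, ENNReal.ofReal (-f x) ∂μ = ⊤
  · have : extIntegral μ f = ⊥ := by
      rw [extIntegral, hfn, ← EReal.coe_ennreal_toReal hfp]
      simp
    rw [this]; simp
  have hfi : Integrable f μ := integrable_of_lintegral_ofReal_ne_top hf hfp hfn
  rw [extIntegral_of_integrable hfi, extIntegral_of_integrable hgi, ← EReal.coe_sub,
    EReal.coe_le_coe_iff, sub_le_iff_le_add', ← integral_add hgi hk]
  exact integral_mono_ae hfi (hgi.add hk) hfg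

end ExtIntegral

variable {ι : Type*} [Fintype ι] {U : (ι → ℝ) → ℝ} {A G : Matrix ι ι ℝ} {μ : Measure (ι → ℝ)}

theorem IsProbWithSecondMoments.integrable_mul (h : IsProbWithSecondMoments μ) (i j : ι) :
    Integrable (fun x : ι → ℝ => x i * x j) μ := by
  refine ((h.integrable_sq i).add (h.integrable_sq j)).mono' (by fun_prop)
    (Eventually.of_forall fun x => ?_)
  rw [Real.norm_eq_abs, abs_le]
  simp only [Pi.add_apply]
  constructor <;> nlinarith [sq_nonneg (x i + x j), sq_nonneg (x i - x j)]

theorem IsProbWithSecondMoments.integrable_quadForm (h : IsProbWithSecondMoments μ)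
    (A : Matrix ι ι ℝ) : Integrable (fun x : ι → ℝ => x ⬝ᵥ A.mulVec x) μ := by
  simp only [quadForm_eq_sum]
  exact integrable_finsetSum _ fun i _ => integrable_finsetSum _ fun j _ =>
    (h.integrable_mul i j).const_mul _

theorem IsProbWithSecondMoments.integral_quadForm (h : IsProbWithSecondMoments μ)
    (A : Matrix ι ι ℝ) : ∫ x, x ⬝ᵥ A.mulVec x ∂μ = pairing A (secondMoment μ) := by
  simp only [quadForm_eq_sum, pairing, secondMoment, Matrix.of_apply]
  have hint : ∀ i j, Integrable (fun x : ι → ℝ => A i j * (x i * x j)) μ := fun i j =>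
    (h.integrable_mul i j).const_mul _
  rw [integral_finsetSum _ fun i _ => integrable_finsetSum _ fun j _ => hint i j]
  refine Finset.sum_congr rfl fun i _ => ?_
  rw [integral_finsetSum _ fun j _ => hint i j]
  exact Finset.sum_congr rfl fun j _ => integral_const_mul _ _

theorem lintegral_neg_potential_ne_top (hU : QuadraticallyBounded U)
    (h : IsProbWithSecondMoments μ) : ∫⁻ x, ENNReal.ofReal (-U x) ∂μ ≠ ⊤ := by
  obtain ⟨C, hC, hb⟩ := hU.lower_bound
  have := h.isProbabilityMeasure
  have hi : Integrable (fun x : ι → ℝ => C * (1 + ∑ i, x i ^ 2)) μ :=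
    ((integrable_const 1).add (integrable_finsetSum _ fun i _ => h.integrable_sq i)).const_mul C
  exact ne_top_of_le_ne_top hi.lintegral_lt_top.ne
    (lintegral_mono fun x => ENNReal.ofReal_le_ofReal (by linarith [hb x]))

/-- The Gibbs variational inequality. -/
theorem entropy_sub_le (hU : QuadraticallyBounded U) (hA : Integrable (weight U A))
    (hμ : IsProbWithSecondMoments μ) :
    entropy μ - extIntegral μ U
      ≤ ((1 / 2 * pairing A (secondMoment μ) + Real.log (∫ x, weight U A x) : ℝ) : EReal) := by
  have hprob := hμ.isProbabilityMeasure
  unfold entropy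
  split_ifs with hac
  swap
  · simp
  set Z := ∫ x, weight U A x with hZ
  have hZ0 : 0 < Z := integral_weight_pos hA
  have hwm := measurable_weight hU.measurable A
  set r : (ι → ℝ) → ENNReal := μ.rnDeriv volume with hr
  have hrm : Measurable r := Measure.measurable_rnDeriv _ _
  -- The Gibbs density relative to `μ`. Its `μ`-integral can be less than `1`, since `μ` may vanish
  -- on part of the space.
  set h : (ι → ℝ) → ℝ := fun x => weight U A x / (Z * (r x).toReal) with hh
  have hhm : Measurable h := hwm.div (measurable_const.mul hrm.ennreal_toReal)
  have hh0 : ∀ x, 0 ≤ h x := fun x =>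
    div_nonneg (weight_pos x).le (mul_nonneg hZ0.le ENNReal.toReal_nonneg)
  have hlint : ∫⁻ x, ENNReal.ofReal (h x) ∂μ ≤ 1 := by
    rw [← lintegral_rnDeriv_mul hac hhm.ennreal_ofReal.aemeasurable]
    have hone : ∫⁻ x, ENNReal.ofReal (weight U A x / Z) = 1 := by
      rw [← ofReal_integral_eq_lintegral_ofReal (hA.div_const Z)
        (Eventually.of_forall fun x => div_nonneg (weight_pos x).le hZ0.le), integral_div,
        div_self hZ0.ne', ENNReal.ofReal_one]
    rw [← hone]
    refine lintegral_mono_ae ?_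
    filter_upwards [Measure.rnDeriv_lt_top μ volume] with x hx
    by_cases h0 : r x = 0
    · rw [← hr, h0]; simp
    have hpos : 0 < (r x).toReal := ENNReal.toReal_pos h0 hx.ne
    rw [← ENNReal.ofReal_toReal (a := μ.rnDeriv volume x) hx.ne,
      ← ENNReal.ofReal_mul ENNReal.toReal_nonneg]
    refine ENNReal.ofReal_le_ofReal (le_of_eq ?_)
    change (r x).toReal * (weight U A x / (Z * (r x).toReal)) = _
    field_simp
  have hhi : Integrable h μ := by
    refine ⟨hhm.aestronglyMeasurable, ?_⟩
    rw [hasFiniteIntegral_iff_ofReal (Eventually.of_forall hh0)]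
    exact hlint.trans_lt ENNReal.one_lt_top
  have hh1 : ∫ x, h x ∂μ ≤ 1 := by
    rw [integral_eq_lintegral_of_nonneg_ae (Eventually.of_forall hh0) hhm.aestronglyMeasurable]
    exact ENNReal.toReal_le_of_le_ofReal zero_le_one (by simpa using hlint)
  set k : (ι → ℝ) → ℝ := fun x =>
    (1 / 2 * (x ⬝ᵥ A.mulVec x) + (Real.log Z - 1)) + h x with hk
  have hqi := (hμ.integrable_quadForm A).const_mul (1 / 2)
  have hqi' : Integrable (fun x : ι → ℝ => 1 / 2 * (x ⬝ᵥ A.mulVec x) + (Real.log Z - 1)) μ :=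
    hqi.add (integrable_const _)
  have hki : Integrable k μ := hqi'.add hhi
  have hle : ∀ᵐ x ∂μ, -Real.log (r x).toReal ≤ U x + k x := by
    filter_upwards [Measure.rnDeriv_pos hac, hac.ae_le (Measure.rnDeriv_lt_top μ volume)]
      with x hx0 hx1
    have hpos : 0 < (r x).toReal := ENNReal.toReal_pos hx0.ne' hx1.ne
    have hhpos : 0 < h x := div_pos (weight_pos x) (mul_pos hZ0 hpos)
    -- The pointwise bound `log h ≤ h - 1` gives nonnegativity of relative entropy without assuming
    -- the entropy finite.
    have h1 := Real.log_le_sub_one_of_pos hhpos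
    have h2 : Real.log (h x)
        = (-(1 / 2) * (x ⬝ᵥ A.mulVec x) - U x) - (Real.log Z + Real.log (r x).toReal) := by
      rw [hh, Real.log_div (weight_pos x).ne' (mul_pos hZ0 hpos).ne', weight, Real.log_exp,
        Real.log_mul hZ0.ne' hpos.ne']
    simp only [hk]
    linarith
  refine (extIntegral_sub_extIntegral_le hrm.ennreal_toReal.log.neg hU.measurable hki
    (lintegral_neg_potential_ne_top hU hμ) hle).trans ?_
  rw [EReal.coe_le_coe_iff, hk, integral_add hqi' hhi,
    integral_add hqi (integrable_const _), integral_const_mul, hμ.integral_quadForm]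
  simp
  linarith

theorem dualFreeEnergy_le (hU : QuadraticallyBounded U) (hA : Integrable (weight U A))
    (G : Matrix ι ι ℝ) :
    dualFreeEnergy U G ≤ ((1 / 2 * pairing A G + Real.log (∫ x, weight U A x) : ℝ) : EReal) := by
  refine iSup₂_le fun μ hμ => ?_
  rw [← hμ.2]
  exact entropy_sub_le hU hA hμ.1

/-- The normalized measure with density proportional to `weight U A`. -/
noncomputable def gibbsMeasure (U : (ι → ℝ) → ℝ) (A : Matrix ι ι ℝ) : Measure (ι → ℝ) :=
  volume.withDensity fun x => ENNReal.ofReal (weight U A x / ∫ y, weight U A y)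

theorem measurable_gibbsDensity (hU : QuadraticallyBounded U) :
    Measurable fun x => weight U A x / ∫ y, weight U A y :=
  (measurable_weight hU.measurable A).div_const _

theorem integral_gibbsMeasure (hU : QuadraticallyBounded U) (hA : Integrable (weight U A))
    (f : (ι → ℝ) → ℝ) :
    ∫ x, f x ∂(gibbsMeasure U A) = (∫ x, f x * weight U A x) / ∫ x, weight U A x := by
  have hZ := integral_weight_pos hA
  rw [gibbsMeasure, integral_withDensity_eq_integral_toReal_smul
    (measurable_gibbsDensity hU).ennreal_ofReal
    (Eventually.of_forall fun x => ENNReal.ofReal_lt_top), ← integral_div]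
  refine integral_congr_ae (Eventually.of_forall fun x => ?_)
  simp only [smul_eq_mul]
  rw [ENNReal.toReal_ofReal (div_nonneg (weight_pos x).le hZ.le)]
  ring

theorem integrable_gibbsMeasure_iff (hU : QuadraticallyBounded U)
    (hA : Integrable (weight U A)) (f : (ι → ℝ) → ℝ) :
    Integrable f (gibbsMeasure U A) ↔ Integrable fun x => f x * weight U A x := by
  have hZ := integral_weight_pos hA
  rw [gibbsMeasure, integrable_withDensity_iff (measurable_gibbsDensity hU).ennreal_ofReal
    (Eventually.of_forall fun x => ENNReal.ofReal_lt_top)]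
  have : (fun x => f x * (ENNReal.ofReal (weight U A x / ∫ y, weight U A y)).toReal)
      = fun x => (∫ y, weight U A y)⁻¹ * (f x * weight U A x) := by
    ext x
    rw [ENNReal.toReal_ofReal (div_nonneg (weight_pos x).le hZ.le)]
    ring
  rw [this, integrable_const_mul_iff (Ne.isUnit (inv_ne_zero hZ.ne'))]

theorem isProbabilityMeasure_gibbsMeasure (hA : Integrable (weight U A)) :
    IsProbabilityMeasure (gibbsMeasure U A) := by
  have hZ := integral_weight_pos hA
  refine ⟨?_⟩
  rw [gibbsMeasure, withDensity_apply _ MeasurableSet.univ, Measure.restrict_univ,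
    ← ofReal_integral_eq_lintegral_ofReal (hA.div_const _)
      (Eventually.of_forall fun x => div_nonneg (weight_pos x).le hZ.le), integral_div,
    div_self hZ.ne', ENNReal.ofReal_one]

/-- The supremum defining `F[G, U]` is attained at a Gibbs measure with second moments `G`. -/
theorem IsGibbs.dualFreeEnergy_eq (hU : QuadraticallyBounded U) (h : IsGibbs U A G) :
    dualFreeEnergy U G
      = ((1 / 2 * pairing A G + Real.log (∫ x, weight U A x) : ℝ) : EReal) := by
  refine le_antisymm (dualFreeEnergy_le hU h.integrable G) ?_
  have hA := h.integrable
  have hZ := integral_weight_pos hA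
  set Z := ∫ x, weight U A x with hZdef
  have hprob := isProbabilityMeasure_gibbsMeasure hA
  have hsm : IsProbWithSecondMoments (gibbsMeasure U A) := by
    refine ⟨hprob, fun i => ?_⟩
    rw [integrable_gibbsMeasure_iff hU hA]
    simpa only [sq] using h.integrable_mul i i
  have hsG : secondMoment (gibbsMeasure U A) = G := by
    ext i j
    rw [secondMoment, Matrix.of_apply, integral_gibbsMeasure hU hA, h.integral_mul,
      mul_div_cancel_right₀ _ hZ.ne']
  have hac : gibbsMeasure U A ≪ volume := withDensity_absolutelyContinuous _ _
  have hUi : Integrable U (gibbsMeasure U A) :=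
    (integrable_gibbsMeasure_iff hU hA U).2 (h.integrable_potential hU)
  have hq := (hsm.integrable_quadForm A).const_mul (1 / 2)
  have hqU : Integrable (fun x => 1 / 2 * (x ⬝ᵥ A.mulVec x) + U x) (gibbsMeasure U A) :=
    hq.add hUi
  have hlog : (fun x => -Real.log (((gibbsMeasure U A).rnDeriv volume x).toReal))
      =ᵐ[gibbsMeasure U A] fun x => (1 / 2 * (x ⬝ᵥ A.mulVec x) + U x) + Real.log Z := by
    have h1 := hac.ae_le (Measure.rnDeriv_withDensity (volume : Measure (ι → ℝ))
      (measurable_gibbsDensity (A := A) hU).ennreal_ofReal)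
    filter_upwards [h1] with x hx
    rw [gibbsMeasure, hx, ENNReal.toReal_ofReal (div_nonneg (weight_pos x).le hZ.le),
      Real.log_div (weight_pos x).ne' hZ.ne', weight, Real.log_exp]
    ring
  have hlogi : Integrable (fun x => -Real.log (((gibbsMeasure U A).rnDeriv volume x).toReal))
      (gibbsMeasure U A) :=
    (integrable_congr hlog).2 (hqU.add (integrable_const _))
  refine le_trans (le_of_eq ?_) (le_iSup₂_of_le (gibbsMeasure U A) ⟨hsm, hsG⟩ le_rfl)
  rw [entropy, if_pos hac, extIntegral_of_integrable hlogi, extIntegral_of_integrable hUi,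
    ← EReal.coe_sub, integral_congr_ae hlog, integral_add hqU (integrable_const _),
    integral_add hq hUi, integral_const_mul, hsm.integral_quadForm, hsG, EReal.coe_eq_coe_iff]
  simp
  ring

end LuttingerWard

/-! ### Coercivity of the dual objective -/

namespace LuttingerWard

open MeasureTheory Filter Topology

variable {ι : Type*} [Fintype ι] {U : (ι → ℝ) → ℝ} {A G : Matrix ι ι ℝ}

section PositiveDefinite

open scoped MatrixOrder

theorem exists_transpose_mul_self_of_posSemidef (hG : G.PosSemidef) :
    ∃ C : Matrix ι ι ℝ, G = C.transpose * C := by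
  classical
  obtain ⟨C, hC⟩ := CStarAlgebra.nonneg_iff_eq_star_mul_self.mp hG.nonneg
  exact ⟨C, by rw [hC, Matrix.star_eq_conjTranspose, Matrix.conjTranspose_eq_transpose_of_trivial]⟩

theorem isSymm_of_posDef {κ : Type*} {G : Matrix κ κ ℝ} (hG : G.PosDef) : G.IsSymm := by
  have := hG.isHermitian
  rwa [Matrix.IsHermitian, Matrix.conjTranspose_eq_transpose_of_trivial] at this

/-- A symmetric matrix whose quadratic form is bounded below by its pairing with a positive definite
matrix vanishes. -/
theorem eq_zero_of_pairing_le_quadForm {E : Matrix ι ι ℝ} (hG : G.PosDef) (hE : E.IsSymm)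
    (h : ∀ x : ι → ℝ, pairing E G ≤ x ⬝ᵥ E.mulVec x) : E = 0 := by
  classical
  have h0 : pairing E G ≤ 0 := by simpa using h 0
  have hnn : ∀ x : ι → ℝ, 0 ≤ x ⬝ᵥ E.mulVec x := by
    intro x
    by_contra hneg
    push Not at hneg
    set q := x ⬝ᵥ E.mulVec x with hq
    -- Scaling `x` by `t` multiplies the negative value `q` by `t ^ 2`; this `t` is large enough to
    -- push it below the pairing.
    set t := 1 + |pairing E G| / (-q) with ht
    have ht1 : 1 ≤ t := by
      have : 0 ≤ |pairing E G| / (-q) := div_nonneg (abs_nonneg _) (by linarith)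
      linarith
    have h1 := h (t • x)
    rw [Matrix.mulVec_smul, smul_dotProduct, dotProduct_smul, smul_eq_mul, smul_eq_mul, ← hq] at h1
    have h2 : t * (-q) = -q + |pairing E G| := by
      rw [ht, add_mul, one_mul, div_mul_cancel₀ _ (neg_pos.2 hneg).ne']
    have h3 : t * (-q) ≤ t * (t * (-q)) :=
      le_mul_of_one_le_left (mul_nonneg (by linarith) (by linarith)) ht1
    have h4 := neg_abs_le (pairing E G)
    nlinarith
  have hEp : E.PosSemidef := by
    refine Matrix.PosSemidef.of_dotProduct_mulVec_nonneg ?_ fun x => by simpa using hnn x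
    rwa [Matrix.IsHermitian, Matrix.conjTranspose_eq_transpose_of_trivial]
  -- With `E = Bᵀ B` and `G = Cᵀ C`, the pairing is the squared Frobenius norm of `B Cᵀ`; being
  -- nonpositive it forces `B Cᵀ = 0`, and `C` is invertible.
  obtain ⟨B, rfl⟩ := exists_transpose_mul_self_of_posSemidef hEp
  obtain ⟨C, rfl⟩ := exists_transpose_mul_self_of_posSemidef hG.posSemidef
  have hC : IsUnit C := by
    rw [Matrix.isUnit_iff_isUnit_det]
    have := hG.det_pos.ne'
    rw [Matrix.det_mul] at this
    exact (right_ne_zero_of_mul this).isUnit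
  have hM : (B * C.transpose).conjTranspose * (B * C.transpose)
      = C * (B.transpose * B) * C.transpose := by
    rw [Matrix.conjTranspose_eq_transpose_of_trivial, Matrix.transpose_mul,
      Matrix.transpose_transpose]
    simp only [Matrix.mul_assoc]
  have htr : ((B * C.transpose).conjTranspose * (B * C.transpose)).trace
      = pairing (B.transpose * B) (C.transpose * C) := by
    rw [pairing_eq_trace hE, hM, Matrix.mul_assoc C, Matrix.trace_mul_comm C, Matrix.mul_assoc]
  have hz : B * C.transpose = 0 := by
    rw [← Matrix.trace_conjTranspose_mul_self_eq_zero_iff]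
    refine le_antisymm (htr.trans_le h0) ?_
    exact (Matrix.posSemidef_conjTranspose_mul_self _).trace_nonneg
  have hB : B = 0 := by
    have hCt : IsUnit C.transpose := (Matrix.isUnit_transpose _).2 hC
    exact (hCt.mul_left_eq_zero).1 hz
  simp [hB]

end PositiveDefinite

/-- The exponential `exp (½ Tr (A G)) Z[A, U]` of the dual objective. -/
noncomputable def dualObjective (U : (ι → ℝ) → ℝ) (G A : Matrix ι ι ℝ) : ENNReal :=
  ∫⁻ x : ι → ℝ, ENNReal.ofReal (Real.exp (1 / 2 * (pairing A G - x ⬝ᵥ A.mulVec x) - U x))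

theorem exp_eq_mul_weight (x : ι → ℝ) :
    Real.exp (1 / 2 * (pairing A G - x ⬝ᵥ A.mulVec x) - U x)
      = Real.exp (1 / 2 * pairing A G) * weight U A x := by
  rw [weight, ← Real.exp_add]; ring_nf

theorem dualObjective_lt_top_iff (hU : Measurable U) :
    dualObjective U G A < ⊤ ↔ Integrable (weight U A) := by
  rw [← integrable_const_mul_iff (Real.exp_pos (1 / 2 * pairing A G)).ne'.isUnit, Integrable,
    and_iff_right ((measurable_weight hU _).const_mul _).aestronglyMeasurable,
    hasFiniteIntegral_iff_ofReal
      (Eventually.of_forall fun x => mul_nonneg (Real.exp_pos _).le (weight_pos x).le)]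
  simp only [dualObjective, exp_eq_mul_weight]

theorem dualObjective_eq (hA : Integrable (weight U A)) :
    dualObjective U G A
      = ENNReal.ofReal (Real.exp (1 / 2 * pairing A G) * ∫ x, weight U A x) := by
  rw [← integral_const_mul, ofReal_integral_eq_lintegral_ofReal (hA.const_mul _)
      (Eventually.of_forall fun x => mul_nonneg (Real.exp_pos _).le (weight_pos x).le)]
  simp only [dualObjective, exp_eq_mul_weight]

attribute [local instance] Matrix.normedAddCommGroup Matrix.normedSpace

/-- Fatou's lemma: for each fixed `x` the integrand is continuous in both matrices. -/
theorem lowerSemicontinuous_dualObjective (hU : Measurable U) :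
    LowerSemicontinuous fun p : Matrix ι ι ℝ × Matrix ι ι ℝ => dualObjective U p.1 p.2 := by
  intro p
  have : FirstCountableTopology (Matrix ι ι ℝ) :=
    inferInstanceAs (FirstCountableTopology (ι → ι → ℝ))
  refine lowerSemicontinuousAt_iff_le_liminf.2 ?_
  refine le_trans (lintegral_mono fun x => ?_) (lintegral_liminf_le fun p => ?_)
  · have hc : Continuous fun p : Matrix ι ι ℝ × Matrix ι ι ℝ => ENNReal.ofReal
        (Real.exp (1 / 2 * (pairing p.2 p.1 - x ⬝ᵥ p.2.mulVec x) - U x)) := by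
      exact ENNReal.continuous_ofReal.comp (by fun_prop)
    exact (hc.tendsto p).liminf_eq.ge
  · fun_prop

/-- The dual objective is coercive, locally uniformly in the positive definite matrix `G`. -/
theorem exists_norm_le_of_dualObjective_le (hU : Measurable U) (hG : G.PosDef) {C : ENNReal}
    (hC : C < ⊤) : ∃ R : ℝ, ∀ᶠ G' in 𝓝 G, ∀ A : Matrix ι ι ℝ, A.IsSymm →
      dualObjective U G' A ≤ C → ‖A‖ ≤ R := by
  set S : Set (Matrix ι ι ℝ) := Metric.sphere 0 1 ∩ {E | E.IsSymm} with hS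
  have hScomp : IsCompact S :=
    (isCompact_sphere _ _).inter_right (isClosed_eq (by fun_prop) (by fun_prop))
  -- It suffices to get growth along rays, uniformly over unit directions; compactness of the sphere
  -- reduces this to a neighbourhood of a single direction.
  have key : ∃ R : ℝ, ∀ᶠ G' in 𝓝 G, ∀ E ∈ S, ∀ s ≥ R, C < dualObjective U G' (s • E) := by
    refine hScomp.induction_on
      (p := fun T => ∃ R : ℝ, ∀ᶠ G' in 𝓝 G, ∀ E ∈ T, ∀ s ≥ R, C < dualObjective U G' (s • E))
      ⟨0, by simp⟩ ?_ ?_ ?_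
    · rintro T T' hTT ⟨R, hR⟩
      exact ⟨R, hR.mono fun G' h E hE => h E (hTT hE)⟩
    · rintro T T' ⟨R, hR⟩ ⟨R', hR'⟩
      refine ⟨max R R', (hR.and hR').mono fun G' h E hE s hs => ?_⟩
      rcases hE with hE | hE
      · exact h.1 E hE s ((le_max_left _ _).trans hs)
      · exact h.2 E hE s ((le_max_right _ _).trans hs)
    · rintro E ⟨hE1, hE2⟩
      -- Near such an `x`, the integrand along the ray grows like `exp (s δ / 2)`, uniformly for
      -- nearby directions and nearby `G'`.
      obtain ⟨x, hx⟩ : ∃ x : ι → ℝ, x ⬝ᵥ E.mulVec x < pairing E G := by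
        by_contra! hcon
        have := eq_zero_of_pairing_le_quadForm hG hE2 hcon
        rw [this] at hE1
        simp at hE1
      obtain ⟨δ, hδ0, hδ⟩ : ∃ δ : ℝ, 0 < δ ∧ δ < pairing E G - x ⬝ᵥ E.mulVec x :=
        exists_between (sub_pos.2 hx)
      have hcont : Continuous fun q : (Matrix ι ι ℝ × Matrix ι ι ℝ) × (ι → ℝ) =>
          pairing q.1.1 q.1.2 - q.2 ⬝ᵥ q.1.1.mulVec q.2 := by fun_prop
      have hev := (hcont.tendsto ((E, G), x)).eventually_const_lt hδ
      rw [nhds_prod_eq, eventually_prod_iff] at hev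
      obtain ⟨P, hP, Q, hQ, hPQ⟩ := hev
      rw [nhds_prod_eq, eventually_prod_iff] at hP
      obtain ⟨P1, hP1, P2, hP2, hP12⟩ := hP
      obtain ⟨B, hBQ, hBo, hxB⟩ := eventually_nhds_iff.1 hQ
      set v := ∫⁻ y in B, ENNReal.ofReal (Real.exp (-U y)) with hv
      -- Only positivity of `v` matters: the value `⊤` is harmless for a lower bound.
      have hv0 : v ≠ 0 := by
        rw [hv, Ne, lintegral_eq_zero_iff (by fun_prop)]
        intro h0
        have h1 : ∀ᵐ y ∂(volume.restrict B), False := h0.mono fun y hy => by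
          simp only [Pi.zero_apply, ENNReal.ofReal_eq_zero] at hy
          exact (Real.exp_pos _).not_ge hy
        rw [eventually_false_iff_eq_bot, ae_eq_bot, Measure.restrict_eq_zero] at h1
        exact (hBo.measure_pos volume ⟨x, hxB⟩).ne' h1
      have htend : Tendsto (fun s : ℝ => ENNReal.ofReal (Real.exp (1 / 2 * (s * δ))) * v) atTop
          (𝓝 ⊤) := by
        have h1 : Tendsto (fun s : ℝ => Real.exp (1 / 2 * (s * δ))) atTop atTop :=
          Real.tendsto_exp_atTop.comp
            ((tendsto_id.atTop_mul_const hδ0).const_mul_atTop (by norm_num))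
        have h2 := ENNReal.Tendsto.mul_const (b := v) (ENNReal.tendsto_ofReal_nhds_top.2 h1)
          (Or.inl ENNReal.top_ne_zero)
        rwa [ENNReal.top_mul hv0] at h2
      obtain ⟨R, hR⟩ := eventually_atTop.1 (htend.eventually_const_lt hC)
      refine ⟨{E' | P1 E'}, mem_nhdsWithin_of_mem_nhds hP1, max R 0, ?_⟩
      filter_upwards [hP2] with G' hG' E' hE' s hs
      refine (hR s ((le_max_left _ _).trans hs)).trans_le ?_
      have hs0 : 0 ≤ s := (le_max_right _ _).trans hs
      rw [hv, ← lintegral_const_mul _ (by fun_prop)]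
      refine le_trans (setLIntegral_mono' hBo.measurableSet fun y hy => ?_)
        (setLIntegral_le_lintegral B _)
      rw [← ENNReal.ofReal_mul (Real.exp_pos _).le, ← Real.exp_add]
      refine ENNReal.ofReal_le_ofReal (Real.exp_le_exp.2 ?_)
      have h1 := (hPQ (hP12 hE' hG') (hBQ y hy)).le
      rw [pairing_smul_left, Matrix.smul_mulVec, dotProduct_smul, smul_eq_mul, ← mul_sub]
      have := mul_le_mul_of_nonneg_left h1 hs0
      simp only at this
      linarith
  obtain ⟨R, hR⟩ := key
  refine ⟨max R 0, hR.mono fun G' h A hA hAC => ?_⟩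
  by_contra! hlt
  have hpos : 0 < ‖A‖ := (le_max_right R 0).trans_lt hlt
  have h1 := h (‖A‖⁻¹ • A) ⟨?_, hA.smul _⟩ ‖A‖ ((le_max_left _ _).trans hlt.le)
  · rw [smul_smul, mul_inv_cancel₀ hpos.ne', one_smul] at h1
    exact absurd hAC (not_le.2 h1)
  · simp [norm_smul, hpos.ne']

end LuttingerWard

/-! ### Existence, uniqueness and continuity of the Gibbs parameter -/

namespace LuttingerWard

open MeasureTheory Filter Topology

variable {ι : Type*} [Fintype ι] {U : (ι → ℝ) → ℝ} {A B G : Matrix ι ι ℝ}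

section SymDirection

variable [DecidableEq ι]

theorem isSymm_symDirection {κ : Type*} [DecidableEq κ] (i j : κ) : (symDirection i j).IsSymm := by
  ext k l
  simp only [symDirection, Matrix.transpose_apply, Matrix.of_apply]
  ring

theorem pairing_symDirection (i j : ι) (G : Matrix ι ι ℝ) :
    pairing (symDirection i j) G = G i j + G j i := by
  simp [pairing, symDirection, add_mul, Finset.sum_add_distrib]

theorem quadForm_symDirection (i j : ι) (x : ι → ℝ) :
    x ⬝ᵥ (symDirection i j).mulVec x = 2 * (x i * x j) := by
  rw [quadForm_eq_pairing, pairing_symDirection, Matrix.vecMulVec_apply, Matrix.vecMulVec_apply]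
  ring

/-- Moving `A` along a symmetric direction is an exponential tilt by `-(x i * x j)`, so ratios of
partition functions become moment generating functions. -/
theorem weight_add_smul_symDirection (i j : ι) (t : ℝ) (x : ι → ℝ) :
    weight U (A + t • symDirection i j) x = Real.exp (t * -(x i * x j)) * weight U A x := by
  rw [weight, weight, ← Real.exp_add, Matrix.add_mulVec, dotProduct_add, Matrix.smul_mulVec,
    dotProduct_smul, quadForm_symDirection, smul_eq_mul]
  ring_nf

/-- The first order condition for a minimizer of the dual objective. -/
theorem isGibbs_of_isMin (hU : WeakGrowth U) (hG : G.IsSymm) (hA : A.IsSymm)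
    (hint : Integrable (weight U A))
    (hmin : ∀ B : Matrix ι ι ℝ, B.IsSymm → dualObjective U G A ≤ dualObjective U G B) :
    IsGibbs U A G := by
  have hQ := hU.quadraticallyBounded
  have hZ := integral_weight_pos hint
  have hprob := isProbabilityMeasure_gibbsMeasure hint
  have key : ∀ i j, Integrable (fun x : ι → ℝ => -(x i * x j)) (gibbsMeasure U A) ∧
      ∫ x, -(x i * x j) ∂(gibbsMeasure U A) = -G i j := by
    intro i j
    set X : (ι → ℝ) → ℝ := fun x => -(x i * x j) with hX
    set f : ℝ → SymMat ι := fun t =>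
      ⟨A + t • symDirection i j, hA.add ((isSymm_symDirection i j).smul t)⟩ with hf
    have hcont : Continuous f := by
      refine Continuous.subtype_mk ?_ _
      fun_prop
    have hdom : ∀ᶠ t in 𝓝 (0 : ℝ), Integrable (weight U (A + t • symDirection i j)) := by
      have h0 : f 0 ∈ freeEnergyDomain U := by
        rw [mem_freeEnergyDomain_iff hU.measurable]
        simpa [hf] using hint
      have hev : ∀ᶠ t in 𝓝 (0 : ℝ), f t ∈ freeEnergyDomain U :=
        hcont.continuousAt.eventually_mem (hU.isOpen_domain.mem_nhds h0)
      exact hev.mono fun t ht => (mem_freeEnergyDomain_iff hU.measurable (f t)).1 ht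
    have hiff : ∀ t, Integrable (fun x => Real.exp (t * X x)) (gibbsMeasure U A) ↔
        Integrable (weight U (A + t • symDirection i j)) := by
      intro t
      rw [integrable_gibbsMeasure_iff hQ hint]
      simp only [← weight_add_smul_symDirection, hX]
    have hmgf : ∀ t, ProbabilityTheory.mgf X (gibbsMeasure U A) t
        = (∫ x, weight U (A + t • symDirection i j) x) / ∫ x, weight U A x := by
      intro t
      rw [ProbabilityTheory.mgf, integral_gibbsMeasure hQ hint]
      simp only [← weight_add_smul_symDirection, hX]
    -- Openness of the domain is what gives a two-sided neighbourhood of `0`, hence second moments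
    -- and differentiability under the integral.
    have hmem : (0 : ℝ) ∈ interior (ProbabilityTheory.integrableExpSet X (gibbsMeasure U A)) := by
      rw [mem_interior_iff_mem_nhds]
      filter_upwards [hdom] with t ht using (hiff t).2 ht
    have hder := ProbabilityTheory.hasDerivAt_mgf hmem
    have hexp : HasDerivAt (fun t : ℝ => Real.exp (t * G i j)) (G i j) 0 := by
      simpa using ((hasDerivAt_id (0 : ℝ)).mul_const (G i j)).exp
    have hprod := hexp.mul hder
    -- This product is the dual objective along the line, divided by its value at `A`; its
    -- derivative at `0` is `G i j` minus the Gibbs mean of `x i * x j`.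
    have hlocmin : IsLocalMin
        ((fun t : ℝ => Real.exp (t * G i j)) * ProbabilityTheory.mgf X (gibbsMeasure U A)) 0 := by
      filter_upwards [hdom] with t ht
      have h1 := hmin (A + t • symDirection i j) (hA.add ((isSymm_symDirection i j).smul t))
      rw [dualObjective_eq hint, dualObjective_eq ht, ENNReal.ofReal_le_ofReal_iff
        (mul_nonneg (Real.exp_pos _).le (integral_weight_pos ht).le), pairing_add_left,
        pairing_smul_left, pairing_symDirection, hG.apply i j, mul_add, Real.exp_add,
        mul_assoc, mul_le_mul_iff_right₀ (Real.exp_pos _)] at h1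
      simp only [Pi.mul_apply, zero_mul, Real.exp_zero, one_mul, ProbabilityTheory.mgf_zero, hmgf t]
      rw [← mul_div_assoc, one_le_div hZ]
      convert h1 using 3
      ring
    have h0 := hlocmin.hasDerivAt_eq_zero hprod
    simp only [zero_mul, Real.exp_zero, one_mul, ProbabilityTheory.mgf_zero, mul_one] at h0
    exact ⟨ProbabilityTheory.integrable_of_mem_interior_integrableExpSet hmem, by linarith⟩
  refine ⟨hA, hint, fun i j => ?_, fun i j => ?_⟩
  · have h1 := (integrable_gibbsMeasure_iff hQ hint _).1 (key i j).1
    simpa using h1.neg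
  · have h2 := (key i j).2
    rw [integral_neg, neg_inj, integral_gibbsMeasure hQ hint, div_eq_iff hZ.ne'] at h2
    exact h2

end SymDirection

/-- A Gibbs measure is determined by its second moments: the strict convexity of the dual
objective. -/
theorem IsGibbs.eq_of_dualObjective_le (hU : Measurable U) (h : IsGibbs U A G) (hG : G.PosDef)
    (hB : B.IsSymm) (hle : dualObjective U G B ≤ dualObjective U G A) : B = A := by
  have hAint := h.integrable
  have hBint : Integrable (weight U B) := (dualObjective_lt_top_iff (G := G) hU).1
    (hle.trans_lt ((dualObjective_lt_top_iff hU).2 hAint))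
  rw [dualObjective_eq hAint, dualObjective_eq hBint, ENNReal.ofReal_le_ofReal_iff
    (mul_nonneg (Real.exp_pos _).le (integral_weight_pos hAint).le)] at hle
  set D := A - B with hD
  -- Up to a constant, `φ` is the log-ratio of the two weights, centred to have mean zero under the
  -- Gibbs measure of `A`. Then `exp φ - 1 - φ ≥ 0` has nonpositive mean, so `φ` vanishes almost
  -- everywhere.
  set φ : (ι → ℝ) → ℝ := fun x => 1 / 2 * (x ⬝ᵥ D.mulVec x) - 1 / 2 * pairing D G with hφ
  have hexp : ∀ x, Real.exp (φ x) * weight U A x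
      = Real.exp (-(1 / 2 * pairing D G)) * weight U B x := by
    intro x
    simp only [hφ, hD, weight, ← Real.exp_add, Matrix.sub_mulVec, dotProduct_sub]
    ring_nf
  have hexpi : Integrable fun x => Real.exp (φ x) * weight U A x := by
    simp only [hexp]
    exact hBint.const_mul _
  have hφi : Integrable fun x => φ x * weight U A x := by
    simp only [hφ, sub_mul, mul_assoc]
    exact ((h.integrable_quadForm D).const_mul _).sub ((hAint.const_mul _).const_mul _)
  have hφ0 : ∫ x, φ x * weight U A x = 0 := by
    simp only [hφ, sub_mul, mul_assoc]
    rw [integral_sub ((h.integrable_quadForm D).const_mul _) ((hAint.const_mul _).const_mul _),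
      integral_const_mul, integral_const_mul, integral_const_mul, h.integral_quadForm, sub_self]
  have hei : Integrable fun x => Real.exp (φ x) * weight U A x - weight U A x := hexpi.sub hAint
  have hfi : Integrable fun x => Real.exp (φ x) * weight U A x - weight U A x
      - φ x * weight U A x := hei.sub hφi
  have hf0 : ∀ x, 0 ≤ Real.exp (φ x) * weight U A x - weight U A x - φ x * weight U A x := by
    intro x
    have h1 := mul_le_mul_of_nonneg_right (Real.add_one_le_exp (φ x))
      (weight_pos (U := U) (A := A) x).le
    linarith
  have hfint : ∫ x, (Real.exp (φ x) * weight U A x - weight U A x - φ x * weight U A x) ≤ 0 := by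
    rw [integral_sub hei hφi, integral_sub hexpi hAint, hφ0, sub_zero, sub_nonpos]
    simp only [hexp]
    rw [integral_const_mul]
    have h1 := mul_le_mul_of_nonneg_left hle (Real.exp_pos (-(1 / 2 * pairing A G))).le
    rw [← mul_assoc, ← mul_assoc, ← Real.exp_add, ← Real.exp_add, neg_add_cancel, Real.exp_zero,
      one_mul] at h1
    refine le_trans (le_of_eq ?_) h1
    rw [hD, pairing_sub_left]
    ring_nf
  have hzero := (integral_eq_zero_iff_of_nonneg hf0 hfi).1
    (le_antisymm hfint (integral_nonneg hf0))
  have hφc : Continuous φ := by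
    simp only [hφ]
    fun_prop
  -- Continuity upgrades almost everywhere to everywhere, since Lebesgue measure charges every
  -- nonempty open set.
  have hφz : φ = 0 := by
    rw [← hφc.ae_eq_iff_eq volume continuous_zero]
    filter_upwards [hzero] with x hx
    by_contra hne
    have h1 := mul_lt_mul_of_pos_right (Real.add_one_lt_exp hne)
      (weight_pos (U := U) (A := A) x)
    simp only [Pi.zero_apply] at hx
    linarith
  have hp : pairing D G = 0 := by
    have := congrFun hφz 0
    simpa [hφ] using this
  have hDz : D = 0 := by
    refine eq_zero_of_pairing_le_quadForm hG (h.isSymm.sub hB) fun x => ?_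
    have := congrFun hφz x
    simp only [hφ, Pi.zero_apply] at this
    linarith
  exact (sub_eq_zero.1 hDz).symm

theorem IsGibbs.dualObjective_le (hU : Measurable U) (h : IsGibbs U A G) (hG : G.PosDef)
    (hB : B.IsSymm) : dualObjective U G A ≤ dualObjective U G B := by
  by_contra! hlt
  exact hlt.ne (by rw [h.eq_of_dualObjective_le hU hG hB hlt.le])

attribute [local instance] Matrix.normedAddCommGroup Matrix.normedSpace

theorem isCompact_closedBall_inter_isSymm (R : ℝ) :
    IsCompact (Metric.closedBall 0 R ∩ {B : Matrix ι ι ℝ | B.IsSymm}) :=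
  (isCompact_closedBall _ _).inter_right (isClosed_eq (by fun_prop) (by fun_prop))

/-- Every positive definite matrix is the second moment matrix of a Gibbs measure. -/
theorem exists_isGibbs (hU : WeakGrowth U) (hG : G.PosDef) :
    ∃ A : Matrix ι ι ℝ, IsGibbs U A G := by
  classical
  obtain ⟨A₀, hA₀, hint₀⟩ := exists_integrable_weight hU.quadraticallyBounded
  have hlt : dualObjective U G A₀ < ⊤ := (dualObjective_lt_top_iff hU.measurable).2 hint₀
  obtain ⟨R, hR⟩ := exists_norm_le_of_dualObjective_le hU.measurable hG hlt
  have hR := hR.self_of_nhds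
  have hlsc : LowerSemicontinuous (dualObjective U G) := fun A m hm =>
    ((Continuous.prodMk_right G).tendsto A).eventually
      (lowerSemicontinuous_dualObjective hU.measurable (G, A) m hm)
  have hmem : ∀ B : Matrix ι ι ℝ, B.IsSymm → dualObjective U G B ≤ dualObjective U G A₀ →
      B ∈ Metric.closedBall 0 R ∩ {B : Matrix ι ι ℝ | B.IsSymm} := fun B hB hle =>
    ⟨by simpa using hR B hB hle, hB⟩
  obtain ⟨A, hA, hmin⟩ := LowerSemicontinuousOn.exists_isMinOn ⟨A₀, hmem A₀ hA₀ le_rfl⟩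
    (isCompact_closedBall_inter_isSymm R) (hlsc.lowerSemicontinuousOn _)
  have hle₀ : dualObjective U G A ≤ dualObjective U G A₀ := hmin (hmem A₀ hA₀ le_rfl)
  refine ⟨A, isGibbs_of_isMin hU (isSymm_of_posDef hG) hA.2
    ((dualObjective_lt_top_iff hU.measurable).1 (hle₀.trans_lt hlt)) fun B hB => ?_⟩
  -- The sublevel set of `A₀` lies in the compact ball; off it, the objective is already at least
  -- its value at `A₀`.
  rcases le_total (dualObjective U G B) (dualObjective U G A₀) with h | h
  · exact hmin (hmem B hB h)
  · exact hle₀.trans h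

/-- The Gibbs parameter depends continuously on the second moment matrix. -/
theorem tendsto_of_isGibbs (hU : Measurable U) {A : Matrix ι ι ℝ → Matrix ι ι ℝ}
    (hA : ∀ G : Matrix ι ι ℝ, G.PosDef → IsGibbs U (A G) G) (hG : G.PosDef) :
    Tendsto A (𝓝[{G | G.PosDef}] G) (𝓝 (A G)) := by
  have hAG := hA G hG
  have hcont : Continuous fun G' => dualObjective U G' (A G) := by
    simp only [dualObjective_eq hAG.integrable]
    exact ENNReal.continuous_ofReal.comp (by fun_prop)
  have hlt : dualObjective U G (A G) < ⊤ := (dualObjective_lt_top_iff hU).2 hAG.integrable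
  -- The slack `1` gives one finite level that bounds the minima for all `G'` near `G`, so that the
  -- parameters `A G'` stay in a fixed ball.
  have hlt1 : dualObjective U G (A G) < dualObjective U G (A G) + 1 :=
    ENNReal.lt_add_right hlt.ne one_ne_zero
  obtain ⟨R, hR⟩ := exists_norm_le_of_dualObjective_le hU hG
    (ENNReal.add_lt_top.2 ⟨hlt, ENNReal.one_lt_top⟩ : dualObjective U G (A G) + 1 < ⊤)
  rw [tendsto_nhds]
  intro O hO hAO
  have hK : IsCompact ((Metric.closedBall 0 R ∩ {B : Matrix ι ι ℝ | B.IsSymm}) ∩ Oᶜ) :=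
    (isCompact_closedBall_inter_isSymm R).inter_right hO.isClosed_compl
  -- By uniqueness `A G` strictly beats each competitor outside `O`; joint lower semicontinuity and
  -- compactness keep this true for nearby `G'`, so minimizers cannot leave `O`.
  have hfar : ∀ᶠ G' in 𝓝 G, ∀ B ∈ (Metric.closedBall 0 R ∩ {B : Matrix ι ι ℝ | B.IsSymm}) ∩ Oᶜ,
      dualObjective U G' (A G) < dualObjective U G' B := by
    refine hK.eventually_forall_of_forall_eventually fun B hB => ?_
    have hne : dualObjective U G (A G) < dualObjective U G B := by
      by_contra! hle
      exact hB.2 (hAG.eq_of_dualObjective_le hU hG hB.1.2 hle ▸ hAO)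
    obtain ⟨m, hm1, hm2⟩ := exists_between hne
    have hev : ∀ᶠ z : Matrix ι ι ℝ × Matrix ι ι ℝ in 𝓝 (G, B), dualObjective U z.1 (A G) < m :=
      (continuous_fst.tendsto (G, B)).eventually ((hcont.tendsto G).eventually_lt_const hm1)
    have hev' : ∀ᶠ z : Matrix ι ι ℝ × Matrix ι ι ℝ in 𝓝 (G, B), m < dualObjective U z.1 z.2 :=
      lowerSemicontinuous_dualObjective hU (G, B) m hm2
    exact (hev.and hev').mono fun z hz => hz.1.trans hz.2
  filter_upwards [self_mem_nhdsWithin, mem_nhdsWithin_of_mem_nhds hfar,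
    mem_nhdsWithin_of_mem_nhds hR,
    mem_nhdsWithin_of_mem_nhds ((hcont.tendsto G).eventually_lt_const hlt1)] with G' h1 h2 h3 h4
  have hA' := hA G' h1
  have hle := hA'.dualObjective_le hU h1 hAG.isSymm
  by_contra hnot
  exact (h2 (A G') ⟨⟨by simpa using h3 _ hA'.isSymm (hle.trans h4.le), hA'.isSymm⟩, hnot⟩).not_ge
    hle

theorem abs_pairing_le (A B : Matrix ι ι ℝ) :
    |pairing A B| ≤ (Fintype.card ι : ℝ) ^ 2 * (‖A‖ * ‖B‖) := by
  rw [pairing]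
  calc |∑ i, ∑ j, A i j * B i j| ≤ ∑ i : ι, ∑ j : ι, ‖A‖ * ‖B‖ := by
        refine (Finset.abs_sum_le_sum_abs _ _).trans (Finset.sum_le_sum fun i _ => ?_)
        refine (Finset.abs_sum_le_sum_abs _ _).trans (Finset.sum_le_sum fun j _ => ?_)
        rw [abs_mul]
        exact mul_le_mul (Matrix.norm_entry_le_entrywise_sup_norm A)
          (Matrix.norm_entry_le_entrywise_sup_norm B) (abs_nonneg _) (norm_nonneg _)
    _ = _ := by simp; ring

/-- Pairing with a fixed matrix, as a continuous linear functional. -/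
noncomputable def pairingCLM (A : Matrix ι ι ℝ) : Matrix ι ι ℝ →L[ℝ] ℝ :=
  LinearMap.toContinuousLinearMap
    { toFun := pairing A
      map_add' := fun G H => by simp [pairing, mul_add, Finset.sum_add_distrib]
      map_smul' := fun c G => by simp [pairing, Finset.mul_sum, mul_left_comm] }

/-- An envelope argument. Testing the dual bound at `H` with `A G`, and at `G` with `A H`, traps the
remainder `F H - F G - ½ ⟨A G, H - G⟩` between `½ ⟨A H - A G, H - G⟩` and `0`. Continuity of `A`
makes this `o(‖H - G‖)`. -/
theorem differentiableOn_dualFreeEnergy (hU : WeakGrowth U) :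
    DifferentiableOn ℝ (fun G => (dualFreeEnergy U G).toReal) {G : Matrix ι ι ℝ | G.PosDef} := by
  have hQ := hU.quadraticallyBounded
  intro G hG
  choose! A hA using fun (G : Matrix ι ι ℝ) (hG : G.PosDef) => exists_isGibbs hU hG
  have hF : ∀ G, G.PosDef → (dualFreeEnergy U G).toReal
      = 1 / 2 * pairing (A G) G + Real.log (∫ x, weight U (A G) x) := fun G hG => by
    rw [(hA G hG).dualFreeEnergy_eq hQ, EReal.toReal_coe]
  have hFle : ∀ G H, G.PosDef → H.PosDef → (dualFreeEnergy U G).toReal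
      ≤ 1 / 2 * pairing (A H) G + Real.log (∫ x, weight U (A H) x) := fun G H hG hH => by
    have := dualFreeEnergy_le hQ (hA H hH).integrable G
    rw [(hA G hG).dualFreeEnergy_eq hQ, EReal.coe_le_coe_iff] at this
    rwa [hF G hG]
  refine ⟨(1 / 2 : ℝ) • pairingCLM (A G), HasFDerivWithinAt.of_isLittleO ?_⟩
  rw [Asymptotics.isLittleO_iff]
  intro c hc
  set n : ℝ := (Fintype.card ι : ℝ) ^ 2 with hn
  have hn0 : 0 ≤ n := by positivity
  have htend := tendsto_of_isGibbs hU.measurable hA hG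
  -- The denominator is `n + 1` because `n = 0` for an empty index type.
  have hsmall : ∀ᶠ H in 𝓝[{G | G.PosDef}] G, ‖A H - A G‖ < c / (n + 1) := by
    have := (htend.sub_const (A G)).norm
    rw [sub_self, norm_zero] at this
    exact this.eventually_lt_const (by positivity)
  filter_upwards [self_mem_nhdsWithin, hsmall] with H hH hs
  have h1 := hFle H G hH hG
  have h2 := hFle G H hG hH
  have h3 := abs_pairing_le (A H - A G) (H - G)
  rw [← hn] at h3
  have h4 : pairing (A H - A G) (H - G)
      = pairing (A H) H - pairing (A H) G - (pairing (A G) H - pairing (A G) G) := by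
    rw [pairing_sub_left, pairing_sub_right, pairing_sub_right]
  have h5 : n * (‖A H - A G‖ * ‖H - G‖) ≤ c * ‖H - G‖ := by
    rw [← mul_assoc]
    gcongr
    calc n * ‖A H - A G‖ ≤ (n + 1) * (c / (n + 1)) := by gcongr; linarith
      _ = c := by field_simp
  change ‖(dualFreeEnergy U H).toReal - (dualFreeEnergy U G).toReal
    - 1 / 2 * pairing (A G) (H - G)‖ ≤ c * ‖H - G‖
  rw [Real.norm_eq_abs, pairing_sub_right, abs_le]
  have h6 := abs_le.1 (h3.trans h5)
  rw [h4] at h6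
  have e1 := hF G hG
  have e2 := hF H hH
  have h7 : 0 ≤ c * ‖H - G‖ := by positivity
  constructor <;> linarith [h6.1, h6.2]

end LuttingerWard

/-! ### The log-determinant and well-definedness of the self-energy -/

namespace LuttingerWard

open MeasureTheory Filter Topology

section LogDet

variable {ι : Type*} [Fintype ι] [DecidableEq ι] {U : (ι → ℝ) → ℝ} {G : Matrix ι ι ℝ}

theorem trace_cfc_log (hG : G.PosDef) : (cfc Real.log G).trace = Real.log G.det := by
  have hH := hG.isHermitian
  rw [hH.cfc_eq, Matrix.IsHermitian.cfc, Unitary.conjStarAlgAut_apply, Matrix.trace_mul_comm,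
    ← Matrix.mul_assoc, Unitary.coe_star_mul_self, Matrix.one_mul, Matrix.trace_diagonal,
    hH.det_eq_prod_eigenvalues]
  simp only [RCLike.ofReal_real_eq_id, id, Function.comp_apply]
  rw [Real.log_prod fun i _ => (hG.eigenvalues_pos i).ne']

attribute [local instance] Matrix.normedAddCommGroup Matrix.normedSpace

theorem differentiable_det : Differentiable ℝ fun G : Matrix ι ι ℝ => G.det := by
  have hentry : ∀ i j : ι, Differentiable ℝ fun G : Matrix ι ι ℝ => G i j := fun i j =>
    ((ContinuousLinearMap.proj (R := ℝ) (φ := fun _ : ι => ℝ) j).comp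
      (ContinuousLinearMap.proj (R := ℝ) (φ := fun _ : ι => ι → ℝ) i)).differentiable
  simp only [Matrix.det_apply]
  fun_prop

theorem selfEnergyWellDefined (hU : WeakGrowth U) : SelfEnergyWellDefined U := by
  refine ⟨fun G hG => ?_, ?_⟩
  · obtain ⟨A, hA⟩ := exists_isGibbs hU hG
    rw [hA.dualFreeEnergy_eq hU.quadraticallyBounded]
    exact ⟨EReal.coe_ne_bot _, EReal.coe_ne_top _⟩
  · have h1 : DifferentiableOn ℝ (fun G : Matrix ι ι ℝ => 2 * (dualFreeEnergy U G).toReal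
        - Real.log G.det - Fintype.card ι * Real.log (2 * Real.pi * Real.exp 1))
        {G | G.PosDef} :=
      (((differentiableOn_dualFreeEnergy hU).const_mul 2).sub
        (differentiable_det.differentiableOn.log fun G hG => (Matrix.PosDef.det_pos hG).ne')).sub_const
          _
    refine h1.congr fun G hG => ?_
    rw [luttingerWard, trace_cfc_log hG]

end LogDet

/-! ### Linear changes of variables -/

section Linear

variable {ι : Type*} [Fintype ι] [DecidableEq ι] {U : (ι → ℝ) → ℝ} {A G T : Matrix ι ι ℝ}

theorem map_mulVec_volume (hT : T.det ≠ 0) :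
    Measure.map (fun x => T.mulVec x) volume = ENNReal.ofReal |T.det⁻¹| • volume := by
  rw [← Real.map_matrix_volume_pi_eq_smul_volume_pi hT]
  rfl

theorem measurableEmbedding_mulVec (hT : T.det ≠ 0) :
    MeasurableEmbedding fun x : ι → ℝ => T.mulVec x := by
  have hc : Continuous fun x : ι → ℝ => T.mulVec x := continuous_const.matrix_mulVec continuous_id
  refine hc.measurable.measurableEmbedding ?_
  exact Matrix.mulVec_injective_of_isUnit ((Matrix.isUnit_iff_isUnit_det T).2 hT.isUnit)

theorem integrable_comp_mulVec_iff (hT : T.det ≠ 0) (f : (ι → ℝ) → ℝ) :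
    Integrable (fun x => f (T.mulVec x)) ↔ Integrable f := by
  have h1 := (measurableEmbedding_mulVec hT).integrable_map_iff (μ := volume) (g := f)
  rw [map_mulVec_volume hT, integrable_smul_measure (by simpa using hT) ENNReal.ofReal_ne_top] at h1
  exact h1.symm

theorem integral_comp_mulVec (hT : T.det ≠ 0) (f : (ι → ℝ) → ℝ) :
    ∫ x, f x = |T.det| * ∫ x, f (T.mulVec x) := by
  have h1 := (measurableEmbedding_mulVec hT).integral_map (μ := volume) f
  rw [map_mulVec_volume hT, integral_smul_measure, ENNReal.toReal_ofReal (abs_nonneg _),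
    smul_eq_mul] at h1
  rw [← h1, ← mul_assoc, ← abs_mul, mul_inv_cancel₀ hT, abs_one, one_mul]

/-- Gibbs measures are covariant under the invertible linear maps that preserve the potential. -/
theorem IsGibbs.mulVec (h : IsGibbs U A G) (hT : T.det ≠ 0) (hUT : ∀ x, U (T.mulVec x) = U x) :
    IsGibbs U ((T⁻¹).transpose * A * T⁻¹) (T * G * T.transpose) ∧
      ∫ x, weight U ((T⁻¹).transpose * A * T⁻¹) x = |T.det| * ∫ x, weight U A x ∧
      pairing ((T⁻¹).transpose * A * T⁻¹) (T * G * T.transpose) = pairing A G := by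
  have hTT : T⁻¹ * T = 1 := Matrix.nonsing_inv_mul _ hT.isUnit
  have hw : ∀ x, weight U ((T⁻¹).transpose * A * T⁻¹) (T.mulVec x) = weight U A x := by
    intro x
    rw [weight, weight, hUT, Matrix.mulVec_mulVec, Matrix.mul_assoc, hTT, Matrix.mul_one,
      ← Matrix.mulVec_mulVec, Matrix.dotProduct_mulVec _ T⁻¹.transpose, Matrix.vecMul_transpose,
      Matrix.mulVec_mulVec, hTT, Matrix.one_mulVec]
  have hquad : ∀ i j (x : ι → ℝ), T.mulVec x i * T.mulVec x j
      = x ⬝ᵥ (Matrix.vecMulVec (T i) (T j)).mulVec x := by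
    intro i j x
    rw [quadForm_eq_sum, Matrix.mulVec, Matrix.mulVec, dotProduct, dotProduct, Finset.sum_mul_sum]
    refine Finset.sum_congr rfl fun k _ => Finset.sum_congr rfl fun l _ => ?_
    rw [Matrix.vecMulVec_apply]
    ring
  have hpair : ∀ i j, pairing (Matrix.vecMulVec (T i) (T j)) G = (T * G * T.transpose) i j := by
    intro i j
    simp only [pairing, Matrix.mul_apply, Matrix.vecMulVec_apply, Matrix.transpose_apply,
      Finset.sum_mul]
    rw [Finset.sum_comm]
    exact Finset.sum_congr rfl fun k _ => Finset.sum_congr rfl fun l _ => by ring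
  have hsymm : ((T⁻¹).transpose * A * T⁻¹).IsSymm := by
    rw [Matrix.IsSymm, Matrix.transpose_mul, Matrix.transpose_mul, Matrix.transpose_transpose,
      h.isSymm.eq, Matrix.mul_assoc]
  have hZ : ∫ x, weight U ((T⁻¹).transpose * A * T⁻¹) x = |T.det| * ∫ x, weight U A x := by
    rw [integral_comp_mulVec hT]
    simp only [hw]
  refine ⟨⟨hsymm, ?_, fun i j => ?_, fun i j => ?_⟩, hZ, ?_⟩
  · rw [← integrable_comp_mulVec_iff hT]
    simpa only [hw] using h.integrable
  · rw [← integrable_comp_mulVec_iff hT]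
    simpa only [hw, hquad] using h.integrable_quadForm _
  · rw [hZ, integral_comp_mulVec hT]
    simp only [hw, hquad]
    rw [h.integral_quadForm, hpair]
    ring
  · rw [pairing_eq_trace hsymm, pairing_eq_trace h.isSymm]
    have : (T⁻¹).transpose * A * T⁻¹ * (T * G * T.transpose)
        = (T⁻¹).transpose * (A * G * T.transpose) := by
      simp only [Matrix.mul_assoc]
      rw [← Matrix.mul_assoc T⁻¹ T, hTT, Matrix.one_mul]
    rw [this, Matrix.trace_mul_comm, Matrix.mul_assoc, ← Matrix.transpose_mul, hTT,
      Matrix.transpose_one, Matrix.mul_one]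

end Linear

/-! ### Standard Gaussian moments -/

section Gaussian

theorem integral_mul_exp_neg_half_sq : ∫ t : ℝ, t * Real.exp (-(1 / 2) * t ^ 2) = 0 := by
  have h := integral_neg_eq_self (fun t : ℝ => t * Real.exp (-(1 / 2) * t ^ 2)) volume
  have hodd : ∀ t : ℝ, -t * Real.exp (-(1 / 2) * (-t) ^ 2)
      = -(t * Real.exp (-(1 / 2) * t ^ 2)) := fun t => by rw [neg_sq, neg_mul]
  simp only [hodd, integral_neg] at h
  linarith

theorem integrable_sq_mul_exp_neg_half_sq :
    Integrable fun t : ℝ => t ^ 2 * Real.exp (-(1 / 2) * t ^ 2) := by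
  simpa using integrable_rpow_mul_exp_neg_mul_sq (b := 1 / 2) (s := 2) (by norm_num) (by norm_num)

theorem integral_exp_neg_half_sq :
    ∫ t : ℝ, Real.exp (-(1 / 2) * t ^ 2) = √(2 * Real.pi) := by
  rw [integral_gaussian]
  congr 1
  ring

/-- Read off from the unit variance of the standard Gaussian. -/
theorem integral_sq_mul_exp_neg_half_sq :
    ∫ t : ℝ, t ^ 2 * Real.exp (-(1 / 2) * t ^ 2) = √(2 * Real.pi) := by
  have h := ProbabilityTheory.variance_id_gaussianReal (μ := 0) (v := 1)
  rw [ProbabilityTheory.variance_eq_integral (by fun_prop)] at h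
  simp only [id, ProbabilityTheory.integral_id_gaussianReal, sub_zero] at h
  rw [ProbabilityTheory.integral_gaussianReal_eq_integral_smul one_ne_zero] at h
  simp only [ProbabilityTheory.gaussianPDFReal, smul_eq_mul, mul_assoc, sub_zero] at h
  rw [integral_const_mul, inv_mul_eq_iff_eq_mul₀ (by positivity)] at h
  simp only [NNReal.coe_one, mul_one] at h
  rw [← h]
  refine integral_congr_ae (Eventually.of_forall fun t => ?_)
  simp only
  rw [mul_comm]
  ring_nf

variable {κ : Type*} [Fintype κ] [DecidableEq κ]

theorem weight_zero_one (y : κ → ℝ) :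
    weight 0 1 y = ∏ k, Real.exp (-(1 / 2) * y k ^ 2) := by
  rw [weight, ← Real.exp_sum, ← Finset.mul_sum, Matrix.one_mulVec]
  simp [dotProduct, sq]

theorem integral_weight_zero_one :
    ∫ y : κ → ℝ, weight 0 1 y = √(2 * Real.pi) ^ Fintype.card κ := by
  simp only [weight_zero_one]
  rw [integral_fintype_prod_volume_eq_pow fun t : ℝ => Real.exp (-(1 / 2) * t ^ 2),
    integral_exp_neg_half_sq]

/-- The standard Gaussian has second moment matrix `1`. -/
theorem isGibbs_zero_one : IsGibbs (0 : (κ → ℝ) → ℝ) 1 1 := by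
  set e : ℝ → ℝ := fun t => Real.exp (-(1 / 2) * t ^ 2) with he
  have hei : Integrable e := integrable_exp_neg_mul_sq (by norm_num)
  set g : κ → κ → κ → ℝ → ℝ := fun i j k t =>
    (if k = i then t else 1) * (if k = j then t else 1) * e t with hg
  have hprod : ∀ i j (y : κ → ℝ), y i * y j * weight 0 1 y = ∏ k, g i j k (y k) := by
    intro i j y
    simp only [hg, Finset.prod_mul_distrib, weight_zero_one, Finset.prod_ite_eq', Finset.mem_univ,
      if_true, he]
  have h1i : Integrable fun t => t * e t := integrable_mul_exp_neg_mul_sq (by norm_num)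
  have hgi : ∀ i j k, Integrable (g i j k) := by
    intro i j k
    simp only [hg]
    split_ifs
    · simp only [← sq]
      exact integrable_sq_mul_exp_neg_half_sq
    · simpa using h1i
    · simpa using h1i
    · simpa using hei
  refine ⟨Matrix.isSymm_one, ?_, fun i j => ?_, fun i j => ?_⟩
  · rw [show weight 0 1 = _ from funext weight_zero_one]
    exact Integrable.fintype_prod (f := fun _ => e) fun _ => hei
  · simp only [hprod]
    exact Integrable.fintype_prod (hgi i j)
  · simp only [hprod]
    rw [integral_fintype_prod_volume_eq_prod, integral_weight_zero_one]
    by_cases hij : i = j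
    · subst hij
      rw [Matrix.one_apply_eq, one_mul]
      refine Finset.prod_eq_pow_card fun k _ => ?_
      simp only [hg]
      split_ifs
      · simp only [← sq]
        exact integral_sq_mul_exp_neg_half_sq
      · simp only [one_mul]
        exact integral_exp_neg_half_sq
    · rw [Matrix.one_apply_ne hij, zero_mul]
      refine Finset.prod_eq_zero (Finset.mem_univ i) ?_
      simp only [hg, if_true, hij, if_false, mul_one]
      exact integral_mul_exp_neg_half_sq

theorem integral_apply_mul_weight_zero_one (i : κ) :
    ∫ y : κ → ℝ, y i * weight 0 1 y = 0 := by
  have hprod : ∀ y : κ → ℝ, y i * weight 0 1 y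
      = ∏ k, (if k = i then y k else 1) * Real.exp (-(1 / 2) * y k ^ 2) := by
    intro y
    simp only [Finset.prod_mul_distrib, weight_zero_one, Finset.prod_ite_eq', Finset.mem_univ,
      if_true]
  simp only [hprod]
  rw [integral_fintype_prod_volume_eq_prod
    fun k t => (if k = i then t else 1) * Real.exp (-(1 / 2) * t ^ 2)]
  refine Finset.prod_eq_zero (Finset.mem_univ i) ?_
  simpa using integral_mul_exp_neg_half_sq

end Gaussian

end LuttingerWard

/-! ### Product structure and reduction to the fragment -/

namespace LuttingerWard

open MeasureTheory Filter Topology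

section SumType

variable {ι κ : Type*} [Fintype ι] [Fintype κ] {f : (ι → ℝ) → ℝ} {g : (κ → ℝ) → ℝ}

theorem integral_sum_mul (f : (ι → ℝ) → ℝ) (g : (κ → ℝ) → ℝ) :
    ∫ z : ι ⊕ κ → ℝ, f (z ∘ Sum.inl) * g (z ∘ Sum.inr) = (∫ x, f x) * ∫ y, g y := by
  have h := (volume_measurePreserving_sumPiEquivProdPi fun _ : ι ⊕ κ => ℝ).integral_comp'
    (g := fun p : (ι → ℝ) × (κ → ℝ) => f p.1 * g p.2)
  rw [← integral_prod_mul]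
  exact h

theorem integrable_sum_mul_iff :
    Integrable (fun z : ι ⊕ κ → ℝ => f (z ∘ Sum.inl) * g (z ∘ Sum.inr)) ↔
      Integrable fun p : (ι → ℝ) × (κ → ℝ) => f p.1 * g p.2 :=
  (volume_measurePreserving_sumPiEquivProdPi fun _ : ι ⊕ κ => ℝ).integrable_comp_emb
    (MeasurableEquiv.measurableEmbedding _) (g := fun p : (ι → ℝ) × (κ → ℝ) => f p.1 * g p.2)

theorem integrable_sum_mul (hf : Integrable f) (hg : Integrable g) :
    Integrable fun z : ι ⊕ κ → ℝ => f (z ∘ Sum.inl) * g (z ∘ Sum.inr) :=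
  integrable_sum_mul_iff.2 (hf.mul_prod hg)

/-- By Fubini almost every slice is integrable, and a slice is a nonzero multiple of `f`. -/
theorem integrable_of_integrable_sum_mul (hg : ∀ y, g y ≠ 0)
    (h : Integrable fun z : ι ⊕ κ → ℝ => f (z ∘ Sum.inl) * g (z ∘ Sum.inr)) : Integrable f := by
  obtain ⟨y, hy⟩ := (integrable_sum_mul_iff.1 h).prod_left_ae.exists
  exact (integrable_mul_const_iff (hg y).isUnit f).1 hy

end SumType

theorem apply_eq_onFragment {ι κ : Type*} {U : (ι ⊕ κ → ℝ) → ℝ}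
    (hdep : DependsOn U (Set.range Sum.inl)) (z : ι ⊕ κ → ℝ) :
    U z = onFragment U (z ∘ Sum.inl) := by
  refine hdep ?_
  rintro _ ⟨i, rfl⟩
  rfl

theorem pairing_fromBlocks_one {ι κ : Type*} [Fintype ι] [Fintype κ] [DecidableEq κ]
    (B H : Matrix ι ι ℝ) :
    pairing (Matrix.fromBlocks B 0 0 1) (Matrix.fromBlocks H 0 0 (1 : Matrix κ κ ℝ))
      = pairing B H + Fintype.card κ := by
  simp [pairing, Fintype.sum_sum_type, Matrix.one_apply]

section Blocks

variable {ι κ : Type*} [Fintype ι] [Fintype κ] [DecidableEq κ]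
  {U : (ι ⊕ κ → ℝ) → ℝ} {B H : Matrix ι ι ℝ}

theorem weight_fromBlocks (hdep : DependsOn U (Set.range Sum.inl)) (z : ι ⊕ κ → ℝ) :
    weight U (Matrix.fromBlocks B 0 0 1) z
      = weight (onFragment U) B (z ∘ Sum.inl) * weight 0 1 (z ∘ Sum.inr) := by
  rw [weight, weight, weight, ← Real.exp_add, apply_eq_onFragment hdep, Matrix.fromBlocks_mulVec,
    Matrix.one_mulVec, Matrix.zero_mulVec, Matrix.zero_mulVec, add_zero, zero_add]
  have : z ⬝ᵥ Sum.elim (B.mulVec (z ∘ Sum.inl)) (z ∘ Sum.inr)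
      = (z ∘ Sum.inl) ⬝ᵥ B.mulVec (z ∘ Sum.inl) + (z ∘ Sum.inr) ⬝ᵥ (z ∘ Sum.inr) := by
    simp [dotProduct, Fintype.sum_sum_type]
  rw [this, Pi.zero_apply]
  ring_nf

theorem integrable_weight_fromBlocks_iff (hdep : DependsOn U (Set.range Sum.inl)) :
    Integrable (weight U (Matrix.fromBlocks B 0 0 1)) ↔ Integrable (weight (onFragment U) B) := by
  rw [show weight U (Matrix.fromBlocks B 0 0 1) = _ from funext (weight_fromBlocks hdep)]
  exact ⟨integrable_of_integrable_sum_mul fun y => (weight_pos y).ne',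
    fun h => integrable_sum_mul h isGibbs_zero_one.integrable⟩

theorem integral_weight_fromBlocks (hdep : DependsOn U (Set.range Sum.inl)) :
    ∫ z, weight U (Matrix.fromBlocks B 0 0 (1 : Matrix κ κ ℝ)) z
      = (∫ x, weight (onFragment U) B x) * √(2 * Real.pi) ^ Fintype.card κ := by
  simp only [weight_fromBlocks hdep]
  rw [integral_sum_mul, integral_weight_zero_one]

/-- The fragment domain is the preimage of the full one under the continuous map `B ↦ diag(B, 1)`,
because the extra variables contribute a convergent Gaussian factor. -/
theorem WeakGrowth.onFragment (hU : WeakGrowth U) (hdep : DependsOn U (Set.range Sum.inl)) :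
    WeakGrowth (onFragment U) := by
  have hmeas : Measurable (LuttingerWard.onFragment U) := by
    refine hU.measurable.comp (measurable_pi_iff.2 ?_)
    rintro (i | k)
    · exact measurable_pi_apply i
    · exact measurable_const
  refine ⟨hmeas, ?_, ?_⟩
  · obtain ⟨C, hC⟩ := hU.lower_bound
    refine ⟨C, fun x => ?_⟩
    simpa [LuttingerWard.onFragment] using hC (Sum.elim x 0)
  · set F : SymMat ι → SymMat (ι ⊕ κ) := fun B =>
      ⟨Matrix.fromBlocks B.1 0 0 1, B.2.fromBlocks (by simp) Matrix.isSymm_one⟩ with hF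
    have hFc : Continuous F := by
      refine Continuous.subtype_mk ?_ _
      exact continuous_subtype_val.matrix_fromBlocks continuous_const continuous_const
        continuous_const
    have : freeEnergyDomain (LuttingerWard.onFragment U) = F ⁻¹' freeEnergyDomain U := by
      ext B
      rw [Set.mem_preimage, mem_freeEnergyDomain_iff hmeas, mem_freeEnergyDomain_iff hU.measurable,
        integrable_weight_fromBlocks_iff hdep]
    rw [this]
    exact hU.isOpen_domain.preimage hFc

/-- The weight is a product over the two blocks, so second moments within a block decouple and mixed
ones vanish, the Gaussian factor being centred. -/
theorem IsGibbs.fromBlocks (hdep : DependsOn U (Set.range Sum.inl))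
    (h : IsGibbs (onFragment U) B H) :
    IsGibbs U (Matrix.fromBlocks B 0 0 1) (Matrix.fromBlocks H 0 0 1) := by
  have hγ := isGibbs_zero_one (κ := κ)
  have hx : ∀ i, Integrable fun x : ι → ℝ => x i * weight (onFragment U) B x := fun i => by
    refine (h.integrable.add (h.integrable_mul i i)).mono' ?_ (Eventually.of_forall fun x => ?_)
    · exact (measurable_pi_apply i).aestronglyMeasurable.mul h.integrable.aestronglyMeasurable
    · have hw := weight_pos (U := onFragment U) (A := B) x
      rw [Real.norm_eq_abs, abs_mul, abs_of_pos hw, Pi.add_apply]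
      have : |x i| ≤ 1 + x i * x i := by
        rw [abs_le]
        constructor <;> nlinarith [sq_nonneg (x i + 1), sq_nonneg (x i - 1)]
      nlinarith
  have hy : ∀ k, Integrable fun y : κ → ℝ => y k * weight 0 1 y := fun k => by
    refine (hγ.integrable.add (hγ.integrable_mul k k)).mono' ?_ (Eventually.of_forall fun y => ?_)
    · exact (measurable_pi_apply k).aestronglyMeasurable.mul hγ.integrable.aestronglyMeasurable
    · have hw := weight_pos (U := 0) (A := 1) y
      rw [Real.norm_eq_abs, abs_mul, abs_of_pos hw, Pi.add_apply]
      have : |y k| ≤ 1 + y k * y k := by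
        rw [abs_le]
        constructor <;> nlinarith [sq_nonneg (y k + 1), sq_nonneg (y k - 1)]
      nlinarith
  have e11 : ∀ i j, (fun z : ι ⊕ κ → ℝ => z (.inl i) * z (.inl j) *
      weight U (Matrix.fromBlocks B 0 0 1) z) = fun z => ((z ∘ Sum.inl) i * (z ∘ Sum.inl) j *
        weight (onFragment U) B (z ∘ Sum.inl)) * weight 0 1 (z ∘ Sum.inr) := fun i j => by
    ext z; rw [weight_fromBlocks hdep]; simp only [Function.comp_apply]; ring
  have e12 : ∀ i k, (fun z : ι ⊕ κ → ℝ => z (.inl i) * z (.inr k) *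
      weight U (Matrix.fromBlocks B 0 0 1) z) = fun z => ((z ∘ Sum.inl) i *
        weight (onFragment U) B (z ∘ Sum.inl)) * ((z ∘ Sum.inr) k * weight 0 1 (z ∘ Sum.inr)) :=
    fun i k => by
      ext z; rw [weight_fromBlocks hdep]; simp only [Function.comp_apply]; ring
  have e21 : ∀ k i, (fun z : ι ⊕ κ → ℝ => z (.inr k) * z (.inl i) *
      weight U (Matrix.fromBlocks B 0 0 1) z) = fun z => ((z ∘ Sum.inl) i *
        weight (onFragment U) B (z ∘ Sum.inl)) * ((z ∘ Sum.inr) k * weight 0 1 (z ∘ Sum.inr)) :=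
    fun k i => by
      ext z; rw [weight_fromBlocks hdep]; simp only [Function.comp_apply]; ring
  have e22 : ∀ k l, (fun z : ι ⊕ κ → ℝ => z (.inr k) * z (.inr l) *
      weight U (Matrix.fromBlocks B 0 0 1) z) = fun z => weight (onFragment U) B (z ∘ Sum.inl) *
        ((z ∘ Sum.inr) k * (z ∘ Sum.inr) l * weight 0 1 (z ∘ Sum.inr)) := fun k l => by
    ext z; rw [weight_fromBlocks hdep]; simp only [Function.comp_apply]; ring
  refine ⟨h.isSymm.fromBlocks (by simp) Matrix.isSymm_one,
    (integrable_weight_fromBlocks_iff hdep).2 h.integrable, ?_, ?_⟩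
  · rintro (i | k) (j | l)
    · rw [e11]; exact integrable_sum_mul (h.integrable_mul i j) hγ.integrable
    · rw [e12]; exact integrable_sum_mul (hx i) (hy l)
    · rw [e21]; exact integrable_sum_mul (hx j) (hy k)
    · rw [e22]; exact integrable_sum_mul h.integrable (hγ.integrable_mul k l)
  · rw [integral_weight_fromBlocks hdep]
    rintro (i | k) (j | l)
    · rw [e11, integral_sum_mul (fun x => x i * x j * weight (onFragment U) B x), h.integral_mul,
        integral_weight_zero_one, Matrix.fromBlocks_apply₁₁, mul_assoc]
    · rw [e12, integral_sum_mul (fun x => x i * weight (onFragment U) B x)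
        (fun y => y l * weight 0 1 y), integral_apply_mul_weight_zero_one]
      simp
    · rw [e21, integral_sum_mul (fun x => x j * weight (onFragment U) B x)
        (fun y => y k * weight 0 1 y), integral_apply_mul_weight_zero_one]
      simp
    · rw [e22, integral_sum_mul _ (fun y => y k * y l * weight 0 1 y), hγ.integral_mul,
        integral_weight_zero_one, Matrix.fromBlocks_apply₂₂]
      ring

variable [DecidableEq ι] {G : Matrix (ι ⊕ κ) (ι ⊕ κ) ℝ}

/-- A positive definite matrix is the image of a block diagonal matrix under a block lower
triangular change of variables. -/
theorem exists_blockTriangular_eq (hG : G.PosDef) :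
    ∃ (L : Matrix κ ι ℝ) (R : Matrix κ κ ℝ),
      G = Matrix.fromBlocks 1 0 L R * Matrix.fromBlocks G.toBlocks₁₁ 0 0 1
        * (Matrix.fromBlocks 1 0 L R).transpose := by
  have h11 : G.toBlocks₁₁.PosDef := hG.submatrix Sum.inl_injective
  have hdet : IsUnit G.toBlocks₁₁.det := h11.det_pos.ne'.isUnit
  have hsymm := isSymm_of_posDef hG
  have h21 : G.toBlocks₂₁ = G.toBlocks₁₂.transpose := by
    ext k i
    exact hsymm.apply _ _
  have hGb : G = Matrix.fromBlocks G.toBlocks₁₁ G.toBlocks₁₂ G.toBlocks₁₂.conjTranspose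
      G.toBlocks₂₂ := by
    rw [Matrix.conjTranspose_eq_transpose_of_trivial, ← h21, Matrix.fromBlocks_toBlocks]
  have := G.toBlocks₁₁.invertibleOfIsUnitDet hdet
  have hS := (Matrix.PosDef.fromBlocks₁₁ G.toBlocks₁₂ G.toBlocks₂₂ h11).1 (hGb ▸ hG.posSemidef)
  obtain ⟨C, hC⟩ := exists_transpose_mul_self_of_posSemidef hS
  rw [Matrix.conjTranspose_eq_transpose_of_trivial] at hGb hC
  have h11s : G.toBlocks₁₁⁻¹.transpose = G.toBlocks₁₁⁻¹ := by
    rw [Matrix.transpose_nonsing_inv, (isSymm_of_posDef h11).eq]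
  -- Block Gaussian elimination: `L` clears the off-diagonal blocks, and `R Rᵀ` is the Schur
  -- complement of `G₁₁`.
  refine ⟨G.toBlocks₁₂.transpose * G.toBlocks₁₁⁻¹, C.transpose, ?_⟩
  rw [Matrix.fromBlocks_transpose, Matrix.fromBlocks_multiply, Matrix.fromBlocks_multiply]
  simp only [Matrix.one_mul, Matrix.mul_one, Matrix.zero_mul, Matrix.mul_zero, add_zero, zero_add,
    Matrix.transpose_one, Matrix.transpose_zero, Matrix.transpose_mul, Matrix.transpose_transpose,
    h11s]
  rw [← hC, Matrix.mul_assoc _ G.toBlocks₁₁⁻¹ G.toBlocks₁₁, Matrix.nonsing_inv_mul _ hdet,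
    Matrix.mul_one, ← Matrix.mul_assoc G.toBlocks₁₁, Matrix.mul_nonsing_inv _ hdet, Matrix.one_mul,
    ← Matrix.mul_assoc, add_sub_cancel]
  exact hGb

/-- The Luttinger-Ward functional depends only on the block of the Green's function on the
fragment. -/
theorem luttingerWard_eq_onFragment (hU : WeakGrowth U) (hdep : DependsOn U (Set.range Sum.inl))
    (hG : G.PosDef) : luttingerWard U G = luttingerWard (onFragment U) G.toBlocks₁₁ := by
  have hV := hU.onFragment hdep
  have h11 : G.toBlocks₁₁.PosDef := hG.submatrix Sum.inl_injective
  obtain ⟨B, hB⟩ := exists_isGibbs hV h11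
  obtain ⟨L, R, hLR⟩ := exists_blockTriangular_eq hG
  set T : Matrix (ι ⊕ κ) (ι ⊕ κ) ℝ := Matrix.fromBlocks 1 0 L R with hT
  have hTdet : T.det = R.det := by rw [hT, Matrix.det_fromBlocks_zero₁₂, Matrix.det_one, one_mul]
  have hGdet : G.det = R.det ^ 2 * G.toBlocks₁₁.det := by
    conv_lhs => rw [hLR]
    rw [Matrix.det_mul, Matrix.det_mul, Matrix.det_transpose, hTdet, Matrix.det_fromBlocks_zero₁₂,
      Matrix.det_one]
    ring
  -- The Schur complement was only used as positive semidefinite; invertibility of `R` comes from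
  -- `det G > 0`.
  have hR : R.det ≠ 0 := by
    intro h0
    have := hG.det_pos
    rw [hGdet, h0] at this
    simp at this
  have hUT : ∀ z, U (T.mulVec z) = U z := by
    intro z
    refine hdep ?_
    rintro _ ⟨i, rfl⟩
    rw [hT, Matrix.fromBlocks_mulVec]
    simp
  obtain ⟨hA, hZ, hp⟩ := (hB.fromBlocks hdep).mulVec (hTdet ▸ hR) hUT
  rw [← hLR] at hA hp
  have hF := hA.dualFreeEnergy_eq hU.quadraticallyBounded
  have hZB := integral_weight_pos hB.integrable
  -- The term `2 log |det R|` from the partition function cancels against `log det G`. The Gaussian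
  -- adds `card κ * (1 + log (2π))` to `2 F`, matching the change in the dimensional constant.
  rw [luttingerWard, luttingerWard, trace_cfc_log hG, trace_cfc_log h11, hF,
    hB.dualFreeEnergy_eq hV.quadraticallyBounded, EReal.toReal_coe, EReal.toReal_coe, hp,
    pairing_fromBlocks_one, hZ, integral_weight_fromBlocks hdep, hTdet, hGdet,
    Real.log_mul (abs_pos.2 hR).ne' (by positivity), Real.log_mul hZB.ne' (by positivity),
    Real.log_mul (pow_ne_zero _ hR) h11.det_pos.ne', Real.log_abs, Real.log_pow, Real.log_pow,
    Real.log_sqrt (by positivity), Real.log_mul (x := 2 * Real.pi) (by positivity)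
      (Real.exp_pos 1).ne', Real.log_exp, Fintype.card_sum]
  push_cast
  ring

/-- Positive definiteness is stable under small symmetric perturbations. -/
theorem eventually_posDef_add_smul {m : Type*} [Fintype m] {G E : Matrix m m ℝ} (hG : G.PosDef)
    (hE : E.IsSymm) : ∀ᶠ t in 𝓝 (0 : ℝ), (G + t • E).PosDef := by
  have hpos : ∀ᶠ t in 𝓝 (0 : ℝ), ∀ x ∈ Metric.sphere (0 : m → ℝ) 1,
      0 < x ⬝ᵥ (G + t • E).mulVec x := by
    refine (isCompact_sphere _ _).eventually_forall_of_forall_eventually fun x hx => ?_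
    have hc : Continuous fun z : ℝ × (m → ℝ) => z.2 ⬝ᵥ (G + z.1 • E).mulVec z.2 := by fun_prop
    refine (hc.tendsto (0, x)).eventually_const_lt ?_
    have hx0 : x ≠ 0 := by
      rintro rfl
      simp at hx
    simpa using hG.dotProduct_mulVec_pos hx0
  filter_upwards [hpos] with t ht
  refine Matrix.PosDef.of_dotProduct_mulVec_pos ?_ fun x hx => ?_
  · rw [Matrix.IsHermitian, Matrix.conjTranspose_eq_transpose_of_trivial]
    exact (isSymm_of_posDef hG).add (hE.smul t)
  · have hn : 0 < ‖x‖ := norm_pos_iff.2 hx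
    have h1 := ht (‖x‖⁻¹ • x) (by simp [norm_smul, hn.ne'])
    rw [Matrix.mulVec_smul, smul_dotProduct, dotProduct_smul, smul_smul, smul_eq_mul] at h1
    rw [star_trivial]
    -- Positivity on the unit sphere extends to all nonzero vectors by homogeneity.
    exact (pos_iff_pos_of_mul_pos h1).1 (by positivity)

theorem selfEnergy_eq_fromBlocks (hU : WeakGrowth U) (hdep : DependsOn U (Set.range Sum.inl))
    (hG : G.PosDef) :
    selfEnergy U G = Matrix.fromBlocks (selfEnergy (onFragment U) G.toBlocks₁₁) 0 0 0 := by
  -- The identity for `Φ` holds only on positive definite matrices, but a derivative at `0` needs it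
  -- only for small `t`. If the direction has zero fragment block, the right-hand function is
  -- constant.
  have hder : ∀ a b, deriv (fun t : ℝ => luttingerWard U (G + t • symDirection a b)) 0
      = deriv (fun t : ℝ => luttingerWard (onFragment U)
          (G.toBlocks₁₁ + t • (symDirection a b).toBlocks₁₁)) 0 := by
    intro a b
    refine Filter.EventuallyEq.deriv_eq ?_
    filter_upwards [eventually_posDef_add_smul hG (isSymm_symDirection a b)] with t ht
    exact luttingerWard_eq_onFragment hU hdep ht
  have hzero : ∀ a b, (symDirection a b).toBlocks₁₁ = (0 : Matrix ι ι ℝ) →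
      selfEnergy U G a b = 0 := by
    intro a b hab
    rw [selfEnergy, Matrix.smul_apply, symGradient, Matrix.of_apply, hder, hab]
    simp
  have hinl : ∀ i j, (symDirection (Sum.inl i : ι ⊕ κ) (Sum.inl j)).toBlocks₁₁
      = symDirection i j := by
    intro i j
    ext k l
    simp [symDirection, Matrix.toBlocks₁₁]
  ext (i | k) (j | l)
  · rw [Matrix.fromBlocks_apply₁₁, selfEnergy, selfEnergy, Matrix.smul_apply, Matrix.smul_apply,
      symGradient, symGradient, Matrix.of_apply, Matrix.of_apply, hder, hinl]
  · exact hzero _ _ (by ext a b; simp [symDirection, Matrix.toBlocks₁₁])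
  · exact hzero _ _ (by ext a b; simp [symDirection, Matrix.toBlocks₁₁])
  · exact hzero _ _ (by ext a b; simp [symDirection, Matrix.toBlocks₁₁])

end Blocks

end LuttingerWard

theorem corollary3p8 (p q : ℕ) (U : (Fin p ⊕ Fin q → ℝ) → ℝ)
    (hU : LuttingerWard.WeakGrowth U)
    (hdep : DependsOn U (Set.range (Sum.inl : Fin p → Fin p ⊕ Fin q))) :
    LuttingerWard.SelfEnergyWellDefined U ∧
    LuttingerWard.SelfEnergyWellDefined (LuttingerWard.onFragment U) ∧
    ∀ G : Matrix (Fin p ⊕ Fin q) (Fin p ⊕ Fin q) ℝ, G.PosDef →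
      LuttingerWard.selfEnergy U G =
        Matrix.fromBlocks
          (LuttingerWard.selfEnergy (LuttingerWard.onFragment U) G.toBlocks₁₁) 0
          0 0 :=
  ⟨LuttingerWard.selfEnergyWellDefined hU,
    LuttingerWard.selfEnergyWellDefined (hU.onFragment hdep),
    fun _ hG => LuttingerWard.selfEnergy_eq_fromBlocks hU hdep hG⟩
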